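/- Let $\theta\in\mathbb R\setminus\mathbb Q$ be Diophantine, i.e. with $\lambda=e^{2\pi i\theta}$ there are $c,r>0$ such that $|\lambda^n-1|\ge c\,n^{-r}$ for every integer $n\ge 1$. Let $F$ be a holomorphic automorphism of $\mathbb C^2$ of the form $$F(z,w)=\bigl(z+f(w)z^2+O(z^3),\ \lambda w+g(w)z+O(z^2)\bigr),$$ where $f,g:\mathbb C\to\mathbb C$ are entire, $f(0)\neq 0$ and $g(w)=O(w^2)$ (all $O$-estimates hold in a neighbourhood of the origin). The Fatou set of $F$ is the set of points having an open neighbourhood on which the iterates $\{F^{\circ n}\}$ form a normal family (every sequence of iterates has a subsequence that converges uniformly on compacta to a holomorphic map into $\mathbb C^2$ or diverges compactly to $\infty$); its connected components are the Fatou components. A limit map of $F$ on a Fatou component $\Omega$ is a map $h:\Omega\to\mathbb C^2\cup\{\infty\}$ for which there is a strictly increasing sequence $n_k$ such that either $h$ is holomorphic into $\mathbb C^2$ and $F^{\circ n_k}\to h$ uniformly on compacta of $\Omega$, or $h\equiv\infty$ and $F^{\circ n_k}$ diverges compactly to $\infty$ on $\Omega$. The $\omega$-limit set of $F$ on $\Omega$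 is the set of all accumulation points in $\mathbb C^2$ of forward orbits of points of $\Omega$. Then $F$ has a Fatou component $\Omega$ that is invariant, $F(\Omega)=\Omega$, and non-recurrent (for every $p\in\Omega$ and every compact $K\subset\Omega$ one has $F^{\circ n}(p)\notin K$ for all sufficiently large $n$), such that every limit map of $F$ on $\Omega$ has image $\{0\}\times\mathbb C$, the $\omega$-limit set of $F$ on $\Omega$ equals $\{0\}\times\mathbb C$, and $\{0\}\times\mathbb C\subset\partial\Omega$. -/

import Mathlib

open Filter Topology

/-- `θ` is irrational and, for `lam = exp (2 π i θ)`, one has `|lam ^ n - 1| ≥ c n ^ (-r)` for all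
`n ≥ 1`, with some constants `c, r > 0`. -/
def IsDiophantine (θ : ℝ) : Prop :=
  Irrational θ ∧ ∃ c r : ℝ, 0 < c ∧ 0 < r ∧ ∀ n : ℕ, 1 ≤ n →
    c * (n : ℝ) ^ (-r) ≤ ‖Complex.exp (2 * Real.pi * Complex.I * θ) ^ n - 1‖

/-- `F` is a holomorphic automorphism of `ℂ²`. -/
def IsHolomorphicAutomorphism (F : ℂ × ℂ → ℂ × ℂ) : Prop :=
  Differentiable ℂ F ∧
    ∃ G : ℂ × ℂ → ℂ × ℂ, Differentiable ℂ G ∧ Function.LeftInverse G F ∧ Function.RightInverse G F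

/-- `F(z, w) = (z + f(w) z² + O(z³), lam w + g(w) z + O(z²))`, where the remainders are estimated
for `(z, w)` in a neighbourhood of the origin of `ℂ²`. -/
def HasForm (F : ℂ × ℂ → ℂ × ℂ) (lam : ℂ) (f g : ℂ → ℂ) : Prop :=
  ((fun p : ℂ × ℂ => (F p).1 - (p.1 + f p.2 * p.1 ^ 2)) =O[𝓝 0] fun p => p.1 ^ 3) ∧
  ((fun p : ℂ × ℂ => (F p).2 - (lam * p.2 + g p.2 * p.1)) =O[𝓝 0] fun p => p.1 ^ 2)

/-- The sequence of maps `G k` diverges to `∞` compactly on `U`. -/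
def CompactlyDivergesOn (G : ℕ → ℂ × ℂ → ℂ × ℂ) (U : Set (ℂ × ℂ)) : Prop :=
  ∀ K ⊆ U, IsCompact K → ∀ L : Set (ℂ × ℂ), IsCompact L →
    ∀ᶠ k in atTop, ∀ p ∈ K, G k p ∉ L

/-- The sequence of maps `G k` converges on `U` to `h : U → ℂ² ∪ {∞}`: either `h` is a holomorphic
map into `ℂ²` and the convergence is uniform on compact subsets of `U`, or `h ≡ ∞` and the
sequence is compactly divergent. (Only the values of `h` on `U` matter.) -/
def ConvergesOnCompacta (G : ℕ → ℂ × ℂ → ℂ × ℂ) (U : Set (ℂ × ℂ))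
    (h : ℂ × ℂ → OnePoint (ℂ × ℂ)) : Prop :=
  (∃ h₀ : ℂ × ℂ → ℂ × ℂ, DifferentiableOn ℂ h₀ U ∧
      (∀ K ⊆ U, IsCompact K → TendstoUniformlyOn G h₀ atTop K) ∧
      ∀ p ∈ U, h p = (h₀ p : OnePoint (ℂ × ℂ))) ∨
  (CompactlyDivergesOn G U ∧ ∀ p ∈ U, h p = OnePoint.infty)

/-- The iterates of `F` form a normal family on `U`: every sequence of iterates has a subsequence
which converges uniformly on compacta of `U` or diverges compactly to `∞`. -/
def IteratesNormalOn (F : ℂ × ℂ → ℂ × ℂ) (U : Set (ℂ × ℂ)) : Prop :=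
  ∀ m : ℕ → ℕ, ∃ φ : ℕ → ℕ, StrictMono φ ∧
    ∃ h : ℂ × ℂ → OnePoint (ℂ × ℂ), ConvergesOnCompacta (fun k => F^[m (φ k)]) U h

/-- The Fatou set of `F`. -/
def fatouSet (F : ℂ × ℂ → ℂ × ℂ) : Set (ℂ × ℂ) :=
  {p | ∃ U : Set (ℂ × ℂ), IsOpen U ∧ p ∈ U ∧ IteratesNormalOn F U}

/-- `Ω` is a connected component of the Fatou set of `F`. -/
def IsFatouComponent (F : ℂ × ℂ → ℂ × ℂ) (Ω : Set (ℂ × ℂ)) : Prop :=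
  ∃ p ∈ fatouSet F, Ω = connectedComponentIn (fatouSet F) p

/-- Every orbit in `Ω` eventually leaves every compact subset of `Ω`. -/
def IsNonRecurrent (F : ℂ × ℂ → ℂ × ℂ) (Ω : Set (ℂ × ℂ)) : Prop :=
  ∀ p ∈ Ω, ∀ K ⊆ Ω, IsCompact K → ∀ᶠ n : ℕ in atTop, F^[n] p ∉ K

/-- `h : Ω → ℂ² ∪ {∞}` is a limit map of `F` on `Ω`. -/
def IsLimitMap (F : ℂ × ℂ → ℂ × ℂ) (Ω : Set (ℂ × ℂ)) (h : ℂ × ℂ → OnePoint (ℂ × ℂ)) : Prop :=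
  ∃ n : ℕ → ℕ, StrictMono n ∧ ConvergesOnCompacta (fun k => F^[n k]) Ω h

/-- The `ω`-limit set of `F` on `Ω`: all accumulation points in `ℂ²` of forward orbits of points
of `Ω`. -/
def omegaLimitOn (F : ℂ × ℂ → ℂ × ℂ) (Ω : Set (ℂ × ℂ)) : Set (ℂ × ℂ) :=
  ⋃ p ∈ Ω, omegaLimit atTop (fun (n : ℕ) (q : ℂ × ℂ) => F^[n] q) {p}

/-- The affine line `{0} × ℂ`. -/
def wAxis : Set (ℂ × ℂ) := {0} ×ˢ Set.univ

/-! Near the line z = 0 the map is parabolic in z and a rotation in w. It is straightened by u = 1/z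
+ φ(w) and V = w + zψ(w), where φ(λw) − φ(w) = f(w) − f(0) and ψ(λw) − λψ(w) = −g(w). Both equations
are solved coefficient by coefficient; the Diophantine bound makes the solutions entire, and g =
O(w²) removes the resonant coefficient in the second. The remainders, controlled only near the
origin, keep their order in z along the whole line by the identity theorem. Hence u ↦ u − f(0) +
O(z) and V ↦ λV + O(z²), uniformly for bounded w (`HasStepEstimates`).

In a thin petal over the disc ‖w‖ < R this gives z_n = O(1/n), so the errors in V are summable, and
λ⁻ⁿ w_n converges uniformly to a holomorphic v with ‖v − w‖ ≤ 1/2 (`HasStepEstimates.orbit`,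
`HasStepEstimates.exists_petal_limit`). So petals lie in the Fatou set, and limits of iterates with
exponents tending to infinity have the form (0, μv) there, with ‖μ‖ = 1. The petals overlap, hence
lie in one component Ω; being close to the identity, v covers arbitrarily large discs as R grows, so
every limit map fills the line.

Normality and the identity theorem spread z_n → 0 from the petals to all of Ω
(`subset_interior_attractedSet`). Finally Ω misses the line: there the first coordinate of every
iterate has derivative dz, which is incompatible with uniform convergence to 0
(`HasForm.zero_prod_notMem`). Non-recurrence and the boundary statement follow. -/

/-! ### Holomorphic functions on complex normed spaces -/

/-- A holomorphic function on a ball of a complex normed space that vanishes near one point of the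
ball vanishes on the whole ball. -/
theorem eq_zero_on_ball_of_eventually_eq_zero {E : Type*} [NormedAddCommGroup E] [NormedSpace ℂ E]
    {f : E → ℂ} {c : E} {r : ℝ} (hf : DifferentiableOn ℂ f (Metric.ball c r)) {a : E}
    (ha : a ∈ Metric.ball c r) (h0 : ∀ᶠ x in 𝓝 a, f x = 0) {q : E} (hq : q ∈ Metric.ball c r) :
    f q = 0 := by
  -- On the complex line through `a` and `q` this is the one-variable identity theorem on a convex
  -- domain containing 0 and 1.
  let L : ℂ → E := fun t => a + t • (q - a)
  have hL : Differentiable ℂ L := by fun_prop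
  have hconv : Convex ℝ (L ⁻¹' Metric.ball c r) := by
    intro s hs t ht x y hx hy hxy
    have := convex_ball c r hs ht hx hy hxy
    have e : L (x • s + y • t) = x • L s + y • L t := by
      have hy' : y = 1 - x := by linarith
      subst hy'
      simp only [L, Complex.real_smul]
      rw [smul_add, smul_add, add_add_add_comm, ← add_smul, hxy, one_smul, add_smul,
        ← Complex.coe_smul, ← Complex.coe_smul, smul_smul, smul_smul]
    rw [Set.mem_preimage, e]
    exact this
  have hopen : IsOpen (L ⁻¹' Metric.ball c r) := Metric.isOpen_ball.preimage hL.continuous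
  have hd : DifferentiableOn ℂ (f ∘ L) (L ⁻¹' Metric.ball c r) :=
    hf.comp hL.differentiableOn (fun _ h => h)
  have hL0 : L 0 = a := by simp [L]
  have hL1 : L 1 = q := by simp [L]
  have h0' : f ∘ L =ᶠ[𝓝 0] 0 := by
    have : Tendsto L (𝓝 0) (𝓝 a) := by
      have := hL.continuous.tendsto 0
      rwa [hL0] at this
    exact this.eventually h0
  have := (hd.analyticOnNhd hopen).eqOn_zero_of_preconnected_of_eventuallyEq_zero
    hconv.isPreconnected (by simpa [hL0] using ha) h0' (x := 1) (by simpa [hL1] using hq)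
  simpa [hL1] using this

/-- Cauchy estimate for the Fréchet derivative. -/
theorem norm_fderiv_le_of_ball {E : Type*} [NormedAddCommGroup E] [NormedSpace ℂ E]
    {f : E → ℂ} {x : E} {r C : ℝ} (hr : 0 < r) (hC : 0 ≤ C)
    (hf : DifferentiableOn ℂ f (Metric.ball x r))
    (hb : ∀ y ∈ Metric.ball x r, ‖f y‖ ≤ C) : ‖fderiv ℂ f x‖ ≤ C / (r / 2) := by
  refine ContinuousLinearMap.opNorm_le_of_unit_norm (𝕜 := ℝ) (f := (fderiv ℂ f x).restrictScalars ℝ)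
    (by positivity) ?_
  intro v hv
  let L : ℂ → E := fun t => x + t • v
  have hL : Differentiable ℂ L := by fun_prop
  have hmem : ∀ t ∈ Metric.closedBall (0 : ℂ) (r / 2), L t ∈ Metric.ball x r := by
    intro t ht
    have : ‖t‖ ≤ r / 2 := by simpa using ht
    simp only [L, Metric.mem_ball, dist_self_add_left, norm_smul, hv]
    linarith
  have hd : DifferentiableOn ℂ (f ∘ L) (Metric.closedBall 0 (r / 2)) :=
    hf.comp hL.differentiableOn hmem
  have hL0 : L 0 = x := by simp [L]
  have hfx : HasFDerivAt f (fderiv ℂ f x) (L 0) := by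
    rw [hL0]
    exact (hf.differentiableAt (Metric.ball_mem_nhds x hr)).hasFDerivAt
  have hLd : HasDerivAt L v 0 := by
    have := ((hasDerivAt_id (0 : ℂ)).smul_const v).const_add x
    rwa [one_smul] at this
  have key := hfx.comp_hasDerivAt (0 : ℂ) hLd
  have := Complex.norm_deriv_le_of_forall_mem_sphere_norm_le (f := f ∘ L) (c := 0) (C := C)
    (half_pos hr) (hd.diffContOnCl_ball (fun _ h => h))
    (fun z hz => hb _ (hmem z (Metric.sphere_subset_closedBall hz)))
  rw [key.deriv] at this
  simpa using this

/-- A uniform limit of holomorphic functions on an open subset of a complex normed space is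
holomorphic. -/
theorem TendstoUniformlyOn.differentiableOn_of_isOpen {E : Type*} [NormedAddCommGroup E]
    [NormedSpace ℂ E] {G : ℕ → E → ℂ} {g : E → ℂ} {U : Set E} (hU : IsOpen U)
    (hG : ∀ n, DifferentiableOn ℂ (G n) U) (h : TendstoUniformlyOn G g atTop U) :
    DifferentiableOn ℂ g U := by
  intro x hx
  obtain ⟨r, hr, hball⟩ := Metric.isOpen_iff.1 hU x hx
  have hsub : ∀ y ∈ Metric.ball x (r / 2), Metric.ball y (r / 2) ⊆ U := by
    intro y hy z hz
    apply hball
    have h1 : dist y x < r / 2 := hy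
    have h2 : dist z y < r / 2 := hz
    have := dist_triangle z y x
    rw [Metric.mem_ball]
    linarith
  have hself : ∀ y ∈ Metric.ball x (r / 2), y ∈ U := fun y hy =>
    hsub y hy (Metric.mem_ball_self (half_pos hr))
  have hc := h.uniformCauchySeqOn
  -- Cauchy estimates on balls of radius r/2 transfer the uniform Cauchy property to the
  -- derivatives, whose limit is then the derivative of `g`.
  have hcd : UniformCauchySeqOn (fun n y => fderiv ℂ (G n) y) atTop (Metric.ball x (r / 2)) := by
    rw [Metric.uniformCauchySeqOn_iff] at hc ⊢
    intro ε hε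
    obtain ⟨N, hN⟩ := hc (ε * (r / 2 / 2) / 2) (by positivity)
    refine ⟨N, fun m hm n hn y hy => ?_⟩
    have hd : ∀ k, DifferentiableAt ℂ (G k) y := fun k =>
      (hG k).differentiableAt (hU.mem_nhds (hself y hy))
    rw [dist_eq_norm, ← fderiv_sub (hd m) (hd n)]
    refine lt_of_le_of_lt (norm_fderiv_le_of_ball (C := ε * (r / 2 / 2) / 2) (half_pos hr)
      (by positivity) (((hG m).mono (hsub y hy)).sub ((hG n).mono (hsub y hy))) ?_) ?_
    · intro z hz
      have := hN m hm n hn z (hsub y hy hz)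
      rw [dist_eq_norm] at this
      exact this.le
    · rw [div_lt_iff₀ (by positivity)]
      nlinarith [mul_pos hε hr]
  have hlim : ∀ y ∈ Metric.ball x (r / 2), ∃ L, Tendsto (fun n => fderiv ℂ (G n) y) atTop (𝓝 L) :=
    fun y hy => cauchySeq_tendsto_of_complete (hcd.cauchySeq hy)
  choose! L hL using hlim
  have hL' := hcd.tendstoUniformlyOn_of_tendsto hL
  exact (hasFDerivAt_of_tendstoUniformlyOn Metric.isOpen_ball hL'
    (fun n y hy => ((hG n).differentiableAt (hU.mem_nhds (hself y hy))).hasFDerivAt)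
    (fun y hy => h.tendsto_at (hself y hy))
    (Metric.mem_ball_self (half_pos hr))).differentiableAt.differentiableWithinAt

/-! ### Order of vanishing along the line z = 0 -/

/-- An entire function of order at least `k` at the origin is divisible by `z ^ k`. -/
theorem exists_eq_pow_mul_of_norm_le {h : ℂ → ℂ} (hh : Differentiable ℂ h) (k : ℕ) {C : ℝ}
    (hb : ∀ z, ‖z‖ ≤ 1 → ‖h z‖ ≤ C * ‖z‖ ^ k) :
    ∃ e : ℂ → ℂ, Differentiable ℂ e ∧ (∀ z, h z = z ^ k * e z) ∧ ∀ z, ‖z‖ ≤ 1 → ‖e z‖ ≤ C := by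
  have main : ∀ (k : ℕ) (h : ℂ → ℂ), Differentiable ℂ h →
      (∀ z, ‖z‖ ≤ 1 → ‖h z‖ ≤ C * ‖z‖ ^ k) →
      ∃ e : ℂ → ℂ, Differentiable ℂ e ∧ (∀ z, h z = z ^ k * e z) := by
    intro k
    induction k with
    | zero => exact fun h hh _ => ⟨h, hh, by simp⟩
    | succ k ih =>
      intro h hh hb
      have h0 : h 0 = 0 := by simpa using hb 0 (by simp)
      have hd : Differentiable ℂ (dslope h 0) := by
        rw [← differentiableOn_univ] at hh ⊢
        exact (Complex.differentiableOn_dslope univ_mem).2 hh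
      have hmul : ∀ z, h z = z * dslope h 0 z := by
        intro z
        have := sub_smul_dslope h 0 z
        simp only [sub_zero, smul_eq_mul, h0] at this
        exact this.symm
      have hne : ∀ z, z ≠ 0 → ‖z‖ ≤ 1 → ‖dslope h 0 z‖ ≤ C * ‖z‖ ^ k := by
        intro z hz hz1
        have := hb z hz1
        rw [hmul, norm_mul, pow_succ] at this
        have hzp := norm_pos_iff.2 hz
        refine le_of_mul_le_mul_left ?_ hzp
        linarith
      obtain ⟨e, he, heq⟩ := ih (dslope h 0) hd (by
        intro z hz1
        by_cases hz : z = 0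
        · subst hz
          -- Division by z loses the bound at 0; continuity restores it.
          have hcont : ContinuousWithinAt (fun z => C * ‖z‖ ^ k - ‖dslope h 0 z‖) {0}ᶜ (0 : ℂ) := by
            have := hd.continuous
            exact Continuous.continuousWithinAt (by fun_prop)
          have hev : ∀ᶠ z in 𝓝[≠] (0 : ℂ), 0 ≤ C * ‖z‖ ^ k - ‖dslope h 0 z‖ := by
            have h1 : ∀ᶠ z in 𝓝[≠] (0 : ℂ), z ∈ Metric.closedBall (0 : ℂ) 1 :=
              mem_nhdsWithin_of_mem_nhds (Metric.closedBall_mem_nhds _ one_pos)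
            filter_upwards [h1, self_mem_nhdsWithin] with z hz hz'
            have := hne z hz' (by simpa using hz)
            linarith
          have := ge_of_tendsto hcont hev
          simpa using this
        · exact hne z hz hz1)
      refine ⟨e, he, fun z => ?_⟩
      rw [hmul, heq]
      ring
  obtain ⟨e, he, heq⟩ := main k h hh hb
  refine ⟨e, he, heq, ?_⟩
  have hne : ∀ z, z ≠ 0 → ‖z‖ ≤ 1 → ‖e z‖ ≤ C := by
    intro z hz hz1
    have := hb z hz1
    rw [heq, norm_mul, norm_pow, mul_comm] at this
    exact le_of_mul_le_mul_right this (pow_pos (norm_pos_iff.2 hz) k)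
  intro z hz1
  by_cases hz : z = 0
  · subst hz
    have hcont : ContinuousWithinAt (fun z => ‖e z‖) {0}ᶜ (0 : ℂ) :=
      he.continuous.norm.continuousWithinAt
    have hev : ∀ᶠ z in 𝓝[≠] (0 : ℂ), ‖e z‖ ≤ C := by
      have h1 : ∀ᶠ z in 𝓝[≠] (0 : ℂ), z ∈ Metric.closedBall (0 : ℂ) 1 :=
        mem_nhdsWithin_of_mem_nhds (Metric.closedBall_mem_nhds _ one_pos)
      filter_upwards [h1, self_mem_nhdsWithin] with z hz hz'
      exact hne z hz' (by simpa using hz)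
    exact le_of_tendsto hcont hev
  · exact hne z hz hz1

/-- If an entire function of two variables is `O(z ^ k)` near the origin, it is so uniformly for
`w` in any given disc. -/
theorem exists_norm_le_pow_of_isBigO {E : ℂ × ℂ → ℂ} (hE : Differentiable ℂ E) (k : ℕ)
    (hO : E =O[𝓝 0] fun p => p.1 ^ k) (R : ℝ) :
    ∃ C : ℝ, 0 ≤ C ∧ ∀ z w : ℂ, ‖z‖ ≤ 1 → ‖w‖ ≤ R → ‖E (z, w)‖ ≤ C * ‖z‖ ^ k := by
  induction k generalizing R with
  | zero =>
    have hK : IsCompact (Metric.closedBall (0 : ℂ) 1 ×ˢ Metric.closedBall (0 : ℂ) R) :=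
      (isCompact_closedBall _ _).prod (isCompact_closedBall _ _)
    obtain ⟨C, hC⟩ := hK.exists_bound_of_continuousOn hE.continuous.continuousOn
    refine ⟨max C 0, le_max_right _ _, fun z w hz hw => ?_⟩
    have := hC (z, w) ⟨by simpa using hz, by simpa using hw⟩
    simpa using Or.inl this
  | succ k ih =>
    have hO' : E =O[𝓝 0] fun p => p.1 ^ k := by
      refine hO.trans ?_
      have h1 : (fun p : ℂ × ℂ => p.1) =O[𝓝 0] fun _ => (1 : ℂ) :=
        (continuous_fst.tendsto (0 : ℂ × ℂ)).isBigO_one ℂ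
      simpa [pow_succ] using (Asymptotics.isBigO_refl (fun p : ℂ × ℂ => p.1 ^ k) (𝓝 0)).mul h1
    have hE1 : ∀ w, Differentiable ℂ fun z => E (z, w) := fun w => by fun_prop
    have hE2 : ∀ z, Differentiable ℂ fun w => E (z, w) := fun w => by fun_prop
    have hex : ∀ w, ∃ e : ℂ → ℂ, Differentiable ℂ e ∧ ∀ z, E (z, w) = z ^ k * e z := by
      intro w
      obtain ⟨C, -, hC⟩ := ih hO' ‖w‖
      obtain ⟨e, he, heq, -⟩ := exists_eq_pow_mul_of_norm_le (hE1 w) k (fun z hz => hC z w hz le_rfl)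
      exact ⟨e, he, heq⟩
    choose e he heq using hex
    have hlip : ∀ R : ℝ, ∃ C : ℝ, 0 ≤ C ∧ ∀ w, ‖w‖ ≤ R → ∀ z, ‖z‖ < 1 →
        ‖e w z - e w 0‖ ≤ C * ‖z‖ := by
      intro R
      obtain ⟨C, hC0, hC⟩ := ih hO' R
      refine ⟨2 * C, by positivity, fun w hw z hz => ?_⟩
      obtain ⟨e', he', heq', hb'⟩ :=
        exists_eq_pow_mul_of_norm_le (hE1 w) k (fun z hz => hC z w hz hw)
      have hee : e' = e w := by
        apply he'.continuous.ext_on (dense_compl_singleton (0 : ℂ)) (he w).continuous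
        intro x hx
        have := (heq' x).symm.trans (heq w x)
        exact mul_left_cancel₀ (pow_ne_zero k hx) this
      rw [hee] at hb'
      -- Schwarz lemma: `e w` is bounded by `C` on the unit disc, so it stays within 2C of `e w 0`.
      have hm : Set.MapsTo (e w) (Metric.ball 0 1) (Metric.closedBall (e w 0) (2 * C)) := by
        intro x hx
        have h1 := hb' x (by simpa using (Metric.mem_ball.1 hx).le)
        have h2 := hb' 0 (by simp)
        rw [mem_closedBall_iff_norm]
        have := norm_sub_le (e w x) (e w 0)
        linarith
      have := Complex.norm_dslope_le_div_of_mapsTo_ball (he w).differentiableOn hm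
        (z := z) (by simpa using hz)
      have hs := sub_smul_dslope (e w) 0 z
      rw [sub_zero, smul_eq_mul] at hs
      rw [← hs, norm_mul, mul_comm]
      exact mul_le_mul_of_nonneg_right (by simpa using this) (norm_nonneg _)
    -- The z^k-coefficient of E is a locally uniform limit of E(z, w)/z^k along z = 1/(n + 2),
    -- points strictly inside the unit disc; hence it is entire in w.
    have hdiff : Differentiable ℂ fun w => e w 0 := by
      intro w₀
      have hU : IsOpen (Metric.ball (0 : ℂ) (‖w₀‖ + 1)) := Metric.isOpen_ball
      obtain ⟨C, hC0, hC⟩ := hlip (‖w₀‖ + 1)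
      have hu : TendstoUniformlyOn (fun (n : ℕ) w => ((n : ℂ) + 2) ^ k * E (((n : ℂ) + 2)⁻¹, w))
          (fun w => e w 0) atTop (Metric.ball (0 : ℂ) (‖w₀‖ + 1)) := by
        rw [Metric.tendstoUniformlyOn_iff]
        intro ε hε
        obtain ⟨N, hN⟩ := exists_nat_gt (C / ε)
        filter_upwards [eventually_ge_atTop N] with n hn w hw
        have hne : ((n : ℂ) + 2) ≠ 0 := by
          have : ((n + 2 : ℕ) : ℂ) ≠ 0 := Nat.cast_ne_zero.2 (by omega)
          simpa using this
        have hnorm : ‖((n : ℂ) + 2)⁻¹‖ = ((n : ℝ) + 2)⁻¹ := by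
          rw [norm_inv]
          congr 1
          have : ((n : ℂ) + 2) = ((n + 2 : ℝ) : ℂ) := by push_cast; ring
          rw [this, Complex.norm_real, Real.norm_of_nonneg (by positivity)]
        rw [heq, ← mul_assoc, ← mul_pow, mul_inv_cancel₀ hne, one_pow, one_mul, dist_comm,
          dist_eq_norm]
        refine lt_of_le_of_lt (hC w (by simpa using (Metric.mem_ball.1 hw).le) _ ?_) ?_
        · rw [hnorm]
          exact inv_lt_one_of_one_lt₀ (by linarith [(Nat.cast_nonneg n : (0 : ℝ) ≤ n)])
        · rw [hnorm, ← div_eq_mul_inv, div_lt_iff₀ (by positivity)]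
          rw [div_lt_iff₀ hε] at hN
          have : (N : ℝ) ≤ n := by exact_mod_cast hn
          nlinarith
      have := TendstoUniformlyOn.differentiableOn_of_isOpen hU (fun n =>
        (((hE2 _).const_mul _).differentiableOn)) hu
      exact this.differentiableAt (hU.mem_nhds (by simp))
    -- The hypothesis kills this coefficient for w near 0, and the identity theorem for every w.
    have hzero : ∀ w, e w 0 = 0 := by
      obtain ⟨C, hC⟩ := hO.bound
      rw [Prod.zero_eq_mk, nhds_prod_eq, Filter.eventually_prod_iff] at hC
      obtain ⟨P, hP, Q, hQ, hPQ⟩ := hC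
      have hev : ∀ᶠ w in 𝓝 (0 : ℂ), e w 0 = 0 := by
        filter_upwards [hQ] with w hw
        have hlim : Tendsto (fun z => ‖e w z‖) (𝓝[≠] 0) (𝓝 ‖e w 0‖) :=
          ((he w).continuous.norm.tendsto 0).mono_left nhdsWithin_le_nhds
        have hlim' : Tendsto (fun z : ℂ => C * ‖z‖) (𝓝[≠] 0) (𝓝 0) := by
          have : Continuous fun z : ℂ => C * ‖z‖ := by fun_prop
          have := (this.tendsto 0).mono_left (nhdsWithin_le_nhds (s := {0}ᶜ))
          simpa using this
        have : ‖e w 0‖ ≤ 0 := by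
          refine le_of_tendsto_of_tendsto hlim hlim' ?_
          filter_upwards [mem_nhdsWithin_of_mem_nhds hP, self_mem_nhdsWithin] with z hz hz0
          have := hPQ hz hw
          rw [heq, norm_mul, norm_pow, norm_pow, pow_succ] at this
          refine le_of_mul_le_mul_left ?_ (pow_pos (norm_pos_iff.2 hz0) k)
          linarith
        simpa using this
      intro w
      have := (hdiff.differentiableOn.analyticOnNhd isOpen_univ)
        |>.eqOn_zero_of_preconnected_of_eventuallyEq_zero isPreconnected_univ (Set.mem_univ 0) hev
      exact this (Set.mem_univ w)
    obtain ⟨C, hC0, hC⟩ := hlip R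
    obtain ⟨C', hC0', hC'⟩ := ih hO' R
    refine ⟨C + C', by positivity, fun z w hz hw => ?_⟩
    -- The Schwarz bound covers the open disc only; on ‖z‖ = 1 the order-k bound is already enough.
    rcases hz.lt_or_eq with hz1 | hz1
    · have := hC w hw z hz1
      rw [hzero, sub_zero] at this
      rw [heq, norm_mul, norm_pow, pow_succ]
      calc ‖z‖ ^ k * ‖e w z‖ ≤ ‖z‖ ^ k * (C * ‖z‖) := by gcongr
        _ ≤ (C + C') * (‖z‖ ^ k * ‖z‖) := by
          have : 0 ≤ C' * (‖z‖ ^ k * ‖z‖) := by positivity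
          linarith
    · have := hC' z w hz hw
      rw [hz1] at this ⊢
      simp only [one_pow, mul_one] at this ⊢
      linarith

/-! ### The cohomological equation -/

/-- Power series expansion of an entire function, with Cauchy estimates for the coefficients. -/
theorem exists_entire_coefficients {a : ℂ → ℂ} (ha : Differentiable ℂ a) :
    ∃ A : ℕ → ℂ, A 0 = a 0 ∧ (∀ w, HasSum (fun n => A n * w ^ n) (a w)) ∧
      ∀ R : ℝ, 0 < R → ∃ M : ℝ, 0 ≤ M ∧ ∀ n, ‖A n‖ ≤ M / R ^ n := by
  refine ⟨fun n => ((n.factorial : ℂ))⁻¹ * iteratedDeriv n a 0, by simp, fun w => ?_,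
    fun R hR => ?_⟩
  · have h := Complex.hasSum_taylorSeries_of_entire ha 0 w
    have e : (fun n : ℕ => ((n.factorial : ℂ))⁻¹ * iteratedDeriv n a 0 * w ^ n) =
        fun n : ℕ => ((n.factorial : ℂ))⁻¹ • (w - 0) ^ n • iteratedDeriv n a 0 := by
      ext n
      rw [smul_eq_mul, smul_eq_mul, sub_zero]
      ring
    rw [e]
    exact h
  · obtain ⟨M, hM⟩ := (isCompact_sphere (0 : ℂ) R).exists_bound_of_continuousOn
      ha.continuous.continuousOn
    refine ⟨max M 0, le_max_right _ _, fun n => ?_⟩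
    have := Complex.norm_iteratedDeriv_le_of_forall_mem_sphere_norm_le n hR ha.diffContOnCl
      (fun z hz => (hM z hz).trans (le_max_left M 0))
    have hf : (0 : ℝ) < n.factorial := by positivity
    rw [norm_mul, norm_inv, Complex.norm_natCast, inv_mul_le_iff₀ hf]
    rwa [mul_div_assoc] at this

/-- The cohomological equation over a Diophantine rotation has an entire solution. -/
theorem exists_entire_cohomological {lam : ℂ} {c r : ℝ} (hc : 0 < c)
    (hlam : ∀ n : ℕ, 1 ≤ n → c * (n : ℝ) ^ (-r) ≤ ‖lam ^ n - 1‖) {a : ℂ → ℂ}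
    (ha : Differentiable ℂ a) (ha0 : a 0 = 0) :
    ∃ φ : ℂ → ℂ, Differentiable ℂ φ ∧ ∀ w, φ (lam * w) - φ w = a w := by
  obtain ⟨A, hA0, hsum, hAb⟩ := exists_entire_coefficients ha
  rw [ha0] at hA0
  -- The term n = 0 is 0/0 = 0, which is correct because `A 0 = 0`.
  let T : ℕ → ℂ → ℂ := fun n w => A n * w ^ n / (lam ^ n - 1)
  have hpos : ∀ n : ℕ, 1 ≤ n → 0 < c * (n : ℝ) ^ (-r) := fun n hn => by
    have : (0 : ℝ) < n := by exact_mod_cast hn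
    positivity
  have hne : ∀ n : ℕ, 1 ≤ n → lam ^ n - 1 ≠ 0 := fun n hn =>
    norm_pos_iff.1 ((hpos n hn).trans_le (hlam n hn))
  have hTb : ∀ R : ℝ, 0 < R → ∃ u : ℕ → ℝ, Summable u ∧ ∀ n, ∀ w ∈ Metric.ball (0 : ℂ) R,
      ‖T n w‖ ≤ u n := by
    intro R hR
    -- Doubling the radius in the Cauchy estimates yields a factor (1/2)^n, which beats the growth
    -- n^r of the inverse small divisors.
    obtain ⟨M, hM0, hM⟩ := hAb (2 * R) (by positivity)
    refine ⟨fun n => M / c * ((n : ℝ) ^ ⌈r⌉₊ * (1 / 2) ^ n), ?_, ?_⟩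
    · have h := summable_pow_mul_geometric_of_norm_lt_one (R := ℝ) ⌈r⌉₊ (r := 1 / 2) (by norm_num)
      exact h.mul_left (M / c)
    · intro n w hw
      rcases Nat.eq_zero_or_pos n with rfl | hn
      · simp only [T, hA0, zero_mul, zero_div, norm_zero]
        positivity
      · have hn1 : (1 : ℝ) ≤ n := by exact_mod_cast hn
        have hw' : ‖w‖ ≤ R := by simpa using (Metric.mem_ball.1 hw).le
        have hr' : (n : ℝ) ^ r ≤ (n : ℝ) ^ ⌈r⌉₊ := by
          rw [← Real.rpow_natCast]
          exact Real.rpow_le_rpow_of_exponent_le hn1 (Nat.le_ceil r)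
        simp only [T, norm_div, norm_mul, norm_pow]
        calc ‖A n‖ * ‖w‖ ^ n / ‖lam ^ n - 1‖
            ≤ M / (2 * R) ^ n * R ^ n / (c * (n : ℝ) ^ (-r)) := by
              gcongr
              · exact hM n
              · exact hlam n hn
          _ = M / c * ((n : ℝ) ^ r * (1 / 2) ^ n) := by
              rw [Real.rpow_neg (by positivity), mul_pow, div_pow, one_pow]
              have : (0 : ℝ) < (n : ℝ) ^ r := by positivity
              field_simp
          _ ≤ _ := by gcongr
  have hTs : ∀ w, Summable fun n => T n w := by
    intro w
    obtain ⟨u, hu, hb⟩ := hTb (‖w‖ + 1) (by positivity)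
    exact Summable.of_norm_bounded hu (fun n => hb n w (by simp))
  refine ⟨fun w => ∑' n, T n w, ?_, ?_⟩
  · intro w
    obtain ⟨u, hu, hb⟩ := hTb (‖w‖ + 1) (by positivity)
    have := Complex.differentiableOn_tsum_of_summable_norm hu (F := T)
      (fun n => by
        have : Differentiable ℂ (T n) := by fun_prop
        exact this.differentiableOn) Metric.isOpen_ball hb
    exact this.differentiableAt (Metric.isOpen_ball.mem_nhds (by simp))
  · intro w
    rw [← (hTs (lam * w)).tsum_sub (hTs w), ← (hsum w).tsum_eq]
    congr 1
    ext n
    rcases Nat.eq_zero_or_pos n with rfl | hn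
    · simp [T, hA0]
    · have := hne n hn
      simp only [T]
      field_simp
      ring

/-! ### One-step estimates in adapted coordinates -/

theorem exists_bound_on_disc {f : ℂ → ℂ} (hf : Continuous f) (R : ℝ) :
    ∃ C : ℝ, 0 ≤ C ∧ ∀ w, ‖w‖ ≤ R → ‖f w‖ ≤ C := by
  obtain ⟨C, hC⟩ := (isCompact_closedBall (0 : ℂ) R).exists_bound_of_continuousOn hf.continuousOn
  exact ⟨max C 0, le_max_right _ _, fun w hw => (hC w (by simpa using hw)).trans (le_max_left _ _)⟩

theorem exists_lipschitz_on_disc {f : ℂ → ℂ} (hf : Differentiable ℂ f) (R : ℝ) :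
    ∃ C : ℝ, 0 ≤ C ∧ ∀ a b, ‖a‖ ≤ R → ‖b‖ ≤ R → ‖f a - f b‖ ≤ C * ‖a - b‖ := by
  obtain ⟨C, hC0, hC⟩ := exists_bound_on_disc
    (hf.contDiff.continuous_deriv le_top : Continuous (deriv f)) R
  refine ⟨C, hC0, fun a b ha hb => ?_⟩
  exact (convex_closedBall (0 : ℂ) R).norm_image_sub_le_of_norm_deriv_le (fun x _ => hf x)
    (fun x hx => hC x (by simpa using hx)) (by simpa using hb) (by simpa using ha)

/-- The estimates for one step of `F` in the coordinates `1 / z + φ w` and `w + z ψ w`, uniform on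
bounded sets of `w`. -/
def HasStepEstimates (F : ℂ × ℂ → ℂ × ℂ) (lam α : ℂ) (φ ψ : ℂ → ℂ) : Prop :=
  ∀ R : ℝ, ∃ C δ : ℝ, 0 ≤ C ∧ 0 < δ ∧ ∀ z w : ℂ, z ≠ 0 → ‖z‖ ≤ δ → ‖w‖ ≤ R →
    (F (z, w)).1 ≠ 0 ∧ ‖(F (z, w)).2 - lam * w‖ ≤ C * ‖z‖ ∧
    ‖((F (z, w)).1⁻¹ + φ (F (z, w)).2) - (z⁻¹ + φ w) + α‖ ≤ C * ‖z‖ ∧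
    ‖((F (z, w)).2 + (F (z, w)).1 * ψ (F (z, w)).2) - lam * (w + z * ψ w)‖ ≤ C * ‖z‖ ^ 2

/-- The equation for φ replaces the increment −f(w) of 1/z by the constant −f(0), and the equation
for ψ cancels the term g(w)z. What remains are the remainders of F, the second-order error of
inversion, and the errors from moving λw to the second coordinate of F and, for ψ, z to the first.
-/
theorem hasStepEstimates_of_cohomological {F : ℂ × ℂ → ℂ × ℂ} {lam : ℂ} {f g φ ψ : ℂ → ℂ}
    (hF : Differentiable ℂ F) (hlam : ‖lam‖ = 1) (hf : Differentiable ℂ f)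
    (hg : Differentiable ℂ g) (hform : HasForm F lam f g)
    (hφ : Differentiable ℂ φ) (hψ : Differentiable ℂ ψ)
    (hφe : ∀ w, φ (lam * w) - φ w = f w - f 0)
    (hψe : ∀ w, ψ (lam * w) - lam * ψ w = -g w) :
    HasStepEstimates F lam (f 0) φ ψ := by
  intro R
  obtain ⟨C₁, hC₁0, hC₁⟩ := exists_norm_le_pow_of_isBigO (by fun_prop) 3 hform.1 R
  obtain ⟨C₂, hC₂0, hC₂⟩ := exists_norm_le_pow_of_isBigO (by fun_prop) 2 hform.2 R
  obtain ⟨A, hA0, hA⟩ := exists_bound_on_disc hf.continuous R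
  obtain ⟨B, hB0, hB⟩ := exists_bound_on_disc hg.continuous R
  obtain ⟨P, hP0, hP⟩ := exists_bound_on_disc hψ.continuous R
  obtain ⟨L₁, hL₁0, hL₁⟩ := exists_lipschitz_on_disc hφ (R + 1)
  obtain ⟨L₂, hL₂0, hL₂⟩ := exists_lipschitz_on_disc hψ (R + 1)
  -- This δ ensures that ‖z‖ ≤ 1, that z moves by at most ‖z‖/2, and that w stays in the disc of
  -- radius R + 1 where the Lipschitz bounds hold.
  set δ : ℝ := 1 / (2 + 2 * (A + C₁) + (B + C₂)) with hδ
  have hden : 0 < 2 + 2 * (A + C₁) + (B + C₂) := by positivity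
  have hδ0 : 0 < δ := by positivity
  have hδe : δ * (2 + 2 * (A + C₁) + (B + C₂)) = 1 := by rw [hδ]; field_simp
  refine ⟨(B + C₂) + (2 * (A * (A + C₁) + C₁) + L₁ * (B + C₂)) +
    (C₂ + 2 * (L₂ * (B + C₂)) + (A + C₁) * P), δ, by positivity, hδ0, ?_⟩
  intro z w hz hzδ hw
  have hz0 : 0 < ‖z‖ := norm_pos_iff.2 hz
  have hδ1 : δ * 2 ≤ 1 := by
    nlinarith [mul_nonneg hδ0.le hA0, mul_nonneg hδ0.le hC₁0,
      mul_nonneg hδ0.le hB0, mul_nonneg hδ0.le hC₂0]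
  have hδ2 : δ * (A + C₁) ≤ 1 / 2 := by
    nlinarith [mul_nonneg hδ0.le hA0, mul_nonneg hδ0.le hC₁0,
      mul_nonneg hδ0.le hB0, mul_nonneg hδ0.le hC₂0]
  have hδ3 : δ * (B + C₂) ≤ 1 := by
    nlinarith [mul_nonneg hδ0.le hA0, mul_nonneg hδ0.le hC₁0,
      mul_nonneg hδ0.le hB0, mul_nonneg hδ0.le hC₂0]
  have hz1 : ‖z‖ ≤ 1 := by linarith
  have h1 := hC₁ z w hz1 hw
  have h2 := hC₂ z w hz1 hw
  have hfw := hA w hw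
  have hgw := hB w hw
  have hlw : ‖lam * w‖ = ‖w‖ := by rw [norm_mul, hlam, one_mul]
  have hψw := hP (lam * w) (hlw.le.trans hw)
  simp only at h1 h2
  generalize F (z, w) = q at h1 h2 ⊢
  obtain ⟨a, b⟩ := q
  simp only at h1 h2 ⊢
  have haz : ‖a - z‖ ≤ (A + C₁) * ‖z‖ ^ 2 := by
    have e : a - z = (a - (z + f w * z ^ 2)) + f w * z ^ 2 := by ring
    have hh : ‖f w * z ^ 2‖ ≤ A * ‖z‖ ^ 2 := by
      rw [norm_mul, norm_pow]; gcongr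
    have h3 : C₁ * ‖z‖ ^ 3 ≤ C₁ * ‖z‖ ^ 2 :=
      mul_le_mul_of_nonneg_left (pow_le_pow_of_le_one hz0.le hz1 (by norm_num)) hC₁0
    rw [e]
    refine (norm_add_le _ _).trans ?_
    linarith
  have hbw : ‖b - lam * w‖ ≤ (B + C₂) * ‖z‖ := by
    have e : b - lam * w = (b - (lam * w + g w * z)) + g w * z := by ring
    have hh : ‖g w * z‖ ≤ B * ‖z‖ := by
      rw [norm_mul]; gcongr
    have h3 : C₂ * ‖z‖ ^ 2 ≤ C₂ * ‖z‖ := by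
      rw [sq]
      exact mul_le_mul_of_nonneg_left (mul_le_of_le_one_left hz0.le hz1) hC₂0
    rw [e]
    refine (norm_add_le _ _).trans ?_
    linarith
  have haz' : ‖a - z‖ ≤ ‖z‖ / 2 := by
    refine haz.trans ?_
    have : (A + C₁) * ‖z‖ ≤ 1 / 2 := by
      have : (A + C₁) * ‖z‖ ≤ (A + C₁) * δ := by gcongr
      linarith
    nlinarith
  have ha_lower : ‖z‖ / 2 ≤ ‖a‖ := by
    have := norm_sub_norm_le z a
    rw [norm_sub_rev] at this
    linarith
  have ha_upper : ‖a‖ ≤ 2 * ‖z‖ := by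
    have := norm_sub_norm_le a z
    linarith
  have ha0 : a ≠ 0 := norm_pos_iff.1 (by linarith)
  have hbR : ‖b‖ ≤ R + 1 := by
    have h4 := norm_sub_norm_le b (lam * w)
    rw [hlw] at h4
    have : (B + C₂) * ‖z‖ ≤ (B + C₂) * δ := by gcongr
    linarith
  have hlwR : ‖lam * w‖ ≤ R + 1 := by rw [hlw]; linarith
  have hu : ‖a⁻¹ - z⁻¹ + f w‖ ≤ 2 * (A * (A + C₁) + C₁) * ‖z‖ := by
    have e : a⁻¹ - z⁻¹ + f w = (f w * z * (a - z) - (a - (z + f w * z ^ 2))) / (z * a) := by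
      field_simp
      ring
    rw [e, norm_div, norm_mul z a, div_le_iff₀ (by positivity)]
    calc ‖f w * z * (a - z) - (a - (z + f w * z ^ 2))‖
        ≤ ‖f w * z * (a - z)‖ + ‖a - (z + f w * z ^ 2)‖ := norm_sub_le _ _
      _ ≤ A * ‖z‖ * ((A + C₁) * ‖z‖ ^ 2) + C₁ * ‖z‖ ^ 3 := by
          rw [norm_mul, norm_mul]
          gcongr
      _ = 2 * (A * (A + C₁) + C₁) * ‖z‖ * (‖z‖ * (‖z‖ / 2)) := by ring
      _ ≤ 2 * (A * (A + C₁) + C₁) * ‖z‖ * (‖z‖ * ‖a‖) := by gcongr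
  have hφb : ‖φ b - φ (lam * w)‖ ≤ L₁ * ((B + C₂) * ‖z‖) :=
    (hL₁ b (lam * w) hbR hlwR).trans (by gcongr)
  have hψb : ‖ψ b - ψ (lam * w)‖ ≤ L₂ * ((B + C₂) * ‖z‖) :=
    (hL₂ b (lam * w) hbR hlwR).trans (by gcongr)
  refine ⟨ha0, ?_, ?_, ?_⟩
  · refine hbw.trans ?_
    rw [add_assoc]
    refine mul_le_mul_of_nonneg_right (le_add_of_nonneg_right ?_) hz0.le
    positivity
  · have e : a⁻¹ + φ b - (z⁻¹ + φ w) + f 0 = (a⁻¹ - z⁻¹ + f w) + (φ b - φ (lam * w)) := by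
      linear_combination hφe w
    rw [e]
    refine (norm_add_le _ _).trans ((add_le_add hu hφb).trans ?_)
    have h5 : 0 ≤ (B + C₂) * ‖z‖ := by positivity
    have h6 : 0 ≤ (C₂ + 2 * (L₂ * (B + C₂)) + (A + C₁) * P) * ‖z‖ := by positivity
    linarith
  · have e : b + a * ψ b - lam * (w + z * ψ w) =
        (b - (lam * w + g w * z)) + a * (ψ b - ψ (lam * w)) + (a - z) * ψ (lam * w) := by
      linear_combination z * hψe w
    rw [e]
    have h7 : ‖a * (ψ b - ψ (lam * w))‖ ≤ 2 * ‖z‖ * (L₂ * ((B + C₂) * ‖z‖)) := by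
      rw [norm_mul]; gcongr
    have h8 : ‖(a - z) * ψ (lam * w)‖ ≤ (A + C₁) * ‖z‖ ^ 2 * P := by
      rw [norm_mul]; gcongr
    refine (norm_add₃_le).trans ((add_le_add (add_le_add h2 h7) h8).trans ?_)
    have h5 : 0 ≤ (B + C₂) * ‖z‖ ^ 2 := by positivity
    have h6 : 0 ≤ (2 * (A * (A + C₁) + C₁) + L₁ * (B + C₂)) * ‖z‖ ^ 2 := by positivity
    linarith

theorem norm_exp_two_pi_mul_I_mul (θ : ℝ) : ‖Complex.exp (2 * Real.pi * Complex.I * θ)‖ = 1 := by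
  have : (2 * Real.pi * Complex.I * θ : ℂ) = ((2 * Real.pi * θ : ℝ) : ℂ) * Complex.I := by
    push_cast; ring
  rw [this, Complex.norm_exp_ofReal_mul_I]

/-- At w^n the equation for ψ has divisor λ^n − λ, which vanishes for n = 1. Writing g = w²e and ψ =
wχ turns it into χ(λw) − χ(w) = −λ⁻¹we(w), whose right-hand side has no constant term. -/
theorem IsDiophantine.exists_hasStepEstimates {F : ℂ × ℂ → ℂ × ℂ} {θ : ℝ} {f g : ℂ → ℂ}
    (hF : Differentiable ℂ F) (hθ : IsDiophantine θ) (hf : Differentiable ℂ f)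
    (hg : Differentiable ℂ g) (hg0 : g =O[𝓝 0] fun w => w ^ 2)
    (hform : HasForm F (Complex.exp (2 * Real.pi * Complex.I * θ)) f g) :
    ∃ φ ψ : ℂ → ℂ, Differentiable ℂ φ ∧ Differentiable ℂ ψ ∧
      HasStepEstimates F (Complex.exp (2 * Real.pi * Complex.I * θ)) (f 0) φ ψ := by
  obtain ⟨-, c, r, hc, -, hlam⟩ := hθ
  have hnorm := norm_exp_two_pi_mul_I_mul θ
  generalize Complex.exp (2 * Real.pi * Complex.I * θ) = lam at *
  have hlam0 : lam ≠ 0 := norm_pos_iff.1 (by rw [hnorm]; exact one_pos)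
  obtain ⟨φ, hφ, hφe⟩ := exists_entire_cohomological hc hlam (hf.sub_const (f 0)) (sub_self _)
  have hO2 : (fun p : ℂ × ℂ => g p.1) =O[𝓝 0] fun p => p.1 ^ 2 :=
    hg0.comp_tendsto (continuous_fst.tendsto (0 : ℂ × ℂ))
  obtain ⟨C, -, hC⟩ := exists_norm_le_pow_of_isBigO (E := fun p => g p.1) (by fun_prop) 2 hO2 0
  obtain ⟨e, he, hge, -⟩ := exists_eq_pow_mul_of_norm_le hg 2
    (fun z hz => hC z 0 hz (by simp))
  obtain ⟨χ, hχ, hχe⟩ := exists_entire_cohomological hc hlam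
    (a := fun w => -lam⁻¹ * (w * e w)) (by fun_prop) (by simp)
  refine ⟨φ, fun w => w * χ w, hφ, by fun_prop,
    hasStepEstimates_of_cohomological hF hnorm hf hg hform hφ (by fun_prop) hφe fun w => ?_⟩
  have h1 := hχe w
  rw [hge]
  have : lam * lam⁻¹ = 1 := mul_inv_cancel₀ hlam0
  linear_combination lam * w * h1 - w ^ 2 * e w * this

/-! ### Petals and quantitative control of orbits -/

/-- The set of `(z, w)` with `‖w‖ < R` for which `-1 / (α z)` lies in the half-plane `M < re`. -/
def petal (α : ℂ) (R M : ℝ) : Set (ℂ × ℂ) := {p | ‖p.2‖ < R ∧ M < (-(α * p.1)⁻¹).re}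

theorem norm_le_of_le_re_inv {α z : ℂ} {t : ℝ} (ht : 0 < t) (h : t ≤ (-(α * z)⁻¹).re) :
    ‖z‖ ≤ ‖α⁻¹‖ / t := by
  have h1 : t ≤ ‖α⁻¹‖ * ‖z‖⁻¹ := by
    refine h.trans ((Complex.re_le_norm _).trans ?_)
    rw [norm_neg, mul_inv, norm_mul, norm_inv z]
  have hz : 0 < ‖z‖ := by
    rcases (norm_nonneg z).lt_or_eq with h2 | h2
    · exact h2
    · rw [← h2, inv_zero, mul_zero] at h1
      linarith
  rw [le_div_iff₀ ht]
  calc ‖z‖ * t ≤ ‖z‖ * (‖α⁻¹‖ * ‖z‖⁻¹) := by gcongr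
    _ = ‖α⁻¹‖ := by field_simp

theorem ne_zero_of_lt_re_inv {α z : ℂ} {t : ℝ} (ht : 0 ≤ t) (h : t < (-(α * z)⁻¹).re) : z ≠ 0 := by
  rintro rfl
  simp only [mul_zero, inv_zero, neg_zero, Complex.zero_re] at h
  linarith

theorem inv_sq_le_telescope {N : ℝ} (hN : 1 < N) (n : ℕ) :
    1 / (N + n) ^ 2 ≤ 1 / (N + n - 1) - 1 / (N + (n + 1 : ℕ) - 1) := by
  have h : (0 : ℝ) ≤ n := Nat.cast_nonneg n
  have h1 : 0 < N + n - 1 := by linarith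
  have h2 : 0 < N + n := by linarith
  push_cast
  have e : N + (n + 1 : ℝ) - 1 = N + n := by ring
  rw [e, div_sub_div _ _ h1.ne' h2.ne', div_le_div_iff₀ (by positivity) (by positivity)]
  nlinarith

/-- Orbits starting in a petal that is thin enough stay near the line `z = 0`, with quantitative
control. -/
theorem HasStepEstimates.orbit {F : ℂ × ℂ → ℂ × ℂ} {lam α : ℂ} {φ ψ : ℂ → ℂ}
    (h : HasStepEstimates F lam α φ ψ) (hlam : ‖lam‖ = 1) (hα : α ≠ 0)
    (hφ : Continuous φ) (hψ : Continuous ψ) (R : ℝ) :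
    ∃ M N D : ℝ, 0 < M ∧ 1 < N ∧ 0 ≤ D ∧ ∀ p ∈ petal α R M,
      ‖p.1 * ψ p.2‖ ≤ 1 / 4 ∧ ∀ n : ℕ,
      (F^[n] p).1 ≠ 0 ∧ ‖(F^[n] p).2‖ ≤ R + 1 ∧
      (N + n) / 2 ≤ (-(α * (F^[n] p).1)⁻¹).re ∧
      ‖(F^[n] p).1‖ ≤ D / (N + n) ∧
      ‖(F^[n] p).1 * ψ (F^[n] p).2‖ ≤ D / (N + n) ∧
      ‖((F^[n] p).2 + (F^[n] p).1 * ψ (F^[n] p).2) - lam ^ n * (p.2 + p.1 * ψ p.2)‖ ≤ 1 / 4 ∧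
      ‖((F^[n + 1] p).2 + (F^[n + 1] p).1 * ψ (F^[n + 1] p).2) -
        lam * ((F^[n] p).2 + (F^[n] p).1 * ψ (F^[n] p).2)‖ ≤ D / (N + n) ^ 2 := by
  obtain ⟨C, δ, hC0, hδ0, hstep⟩ := h (R + 1)
  obtain ⟨P, hP0, hP⟩ := exists_bound_on_disc hφ (R + 2)
  obtain ⟨Q, hQ0, hQ⟩ := exists_bound_on_disc hψ (R + 2)
  set b : ℝ := ‖α⁻¹‖ with hb
  have hb0 : 0 < b := norm_pos_iff.2 (inv_ne_zero hα)
  -- Beyond the first, the summands guarantee in turn: ‖z‖ ≤ δ; one step moves w by at most 1 up to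
  -- rotation; the error in U is at most 1/2; ‖zψ‖ ≤ 1/4; the total drift of V is at most 1/4.
  set N : ℝ := 2 + 2 * b / δ + 2 * b * C + 4 * b ^ 2 * C + 8 * b * Q + 16 * C * b ^ 2 with hN
  have hδb : 0 ≤ 2 * b / δ := by positivity
  have hCb : 0 ≤ b * C := by positivity
  have hCb2 : 0 ≤ b ^ 2 * C := by positivity
  have hbQ : 0 ≤ b * Q := by positivity
  have hN2 : 2 ≤ N := by linarith
  have hN0 : 0 < N := by linarith
  -- Re(−1/(αz)) differs from U by at most bP; passing to U at time 0 and back at time n costs 2bP.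
  set M : ℝ := N / 2 + 2 * (b * P) with hM
  have hbP : 0 ≤ b * P := by positivity
  -- bounds for points deep in the half-plane
  have hsmall : ∀ (n : ℕ) (z : ℂ), (N + n) / 2 ≤ (-(α * z)⁻¹).re → ‖z‖ ≤ 2 * b / (N + n) := by
    intro n z hz
    have hn : (0 : ℝ) ≤ n := Nat.cast_nonneg n
    have := norm_le_of_le_re_inv (by linarith) hz
    rw [← hb] at this
    exact this.trans (le_of_eq (by rw [div_div_eq_mul_div, mul_comm]))
  have hsmall' : ∀ n : ℕ, 2 * b / (N + n) ≤ 2 * b / N := by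
    intro n
    have hn : (0 : ℝ) ≤ n := Nat.cast_nonneg n
    gcongr
    linarith
  have hNδ : 2 * b / N ≤ δ := by
    rw [div_le_iff₀ hN0]
    have : 2 * b = δ * (2 * b / δ) := by field_simp
    nlinarith
  have hNC : C * (2 * b / N) ≤ 1 := by
    rw [← mul_div_assoc, div_le_iff₀ hN0]; linarith
  have hNbC : b * (C * (2 * b / N)) ≤ 1 / 2 := by
    rw [← mul_div_assoc, ← mul_div_assoc, div_le_iff₀ hN0]; linarith
  have hNQ : 2 * b / N * Q ≤ 1 / 4 := by
    rw [div_mul_eq_mul_div, div_le_iff₀ hN0]; linarith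
  have hND : 4 * C * b ^ 2 * (1 / (N - 1)) ≤ 1 / 4 := by
    rw [mul_one_div, div_le_iff₀ (by linarith)]; linarith
  have hφre : ∀ w, ‖w‖ ≤ R + 2 → ‖α⁻¹ * φ w‖ ≤ b * P := by
    intro w hw
    rw [norm_mul]
    gcongr
    exact hP w hw
  refine ⟨M, N, 2 * b + 2 * b * Q + 4 * C * b ^ 2, by positivity, by linarith, by positivity, ?_⟩
  intro p hp
  obtain ⟨hpR, hpM⟩ := hp
  have hp1 : p.1 ≠ 0 := ne_zero_of_lt_re_inv (by positivity) hpM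
  have hpz : ‖p.1‖ ≤ 2 * b / N := by
    have := hsmall 0 p.1 (by push_cast; linarith)
    simpa using this
  have hpψ : ‖p.1 * ψ p.2‖ ≤ 1 / 4 := by
    rw [norm_mul]
    refine le_trans ?_ hNQ
    gcongr
    exact hQ _ (by linarith)
  set V : ℂ × ℂ → ℂ := fun q => q.2 + q.1 * ψ q.2 with hV
  set U : ℂ × ℂ → ℝ := fun q => (-α⁻¹ * (q.1⁻¹ + φ q.2)).re with hU
  have hUX : ∀ q : ℂ × ℂ, ‖q.2‖ ≤ R + 2 → |U q - (-(α * q.1)⁻¹).re| ≤ b * P := by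
    intro q hq
    have e : U q - (-(α * q.1)⁻¹).re = (-(α⁻¹ * φ q.2)).re := by
      simp only [hU]
      rw [← Complex.sub_re, mul_inv]
      congr 1
      ring
    rw [e]
    refine (Complex.abs_re_le_norm _).trans ?_
    rw [norm_neg]
    exact hφre _ hq
  have one_step : ∀ (n : ℕ) (q : ℂ × ℂ), q.1 ≠ 0 → ‖q.2‖ ≤ R + 1 →
      (N + n) / 2 ≤ (-(α * q.1)⁻¹).re →
      (F q).1 ≠ 0 ∧ ‖(F q).2‖ ≤ R + 2 ∧ U q + 1 / 2 ≤ U (F q) ∧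
      ‖V (F q) - lam * V q‖ ≤ 4 * C * b ^ 2 * (1 / (N + n) ^ 2) := by
    intro n q hq1 hq2 hqX
    have hqz := hsmall n q.1 hqX
    have hqz' : ‖q.1‖ ≤ 2 * b / N := hqz.trans (hsmall' n)
    obtain ⟨h1, h2, h3, h4⟩ := hstep q.1 q.2 hq1 (hqz'.trans hNδ) hq2
    rw [Prod.mk.eta] at h1 h2 h3 h4
    have hCz : C * ‖q.1‖ ≤ C * (2 * b / N) := by gcongr
    refine ⟨h1, ?_, ?_, ?_⟩
    · have h5 := norm_sub_norm_le (F q).2 (lam * q.2)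
      rw [norm_mul, hlam, one_mul] at h5
      linarith
    · have e : U (F q) - U q - 1 =
          (-α⁻¹ * ((F q).1⁻¹ + φ (F q).2 - (q.1⁻¹ + φ q.2) + α)).re := by
        have : (1 : ℝ) = (α⁻¹ * α : ℂ).re := by rw [inv_mul_cancel₀ hα, Complex.one_re]
        simp only [hU]
        rw [this, ← Complex.sub_re, ← Complex.sub_re]
        congr 1
        ring
      have h6 : |U (F q) - U q - 1| ≤ b * (C * (2 * b / N)) := by
        rw [e]
        refine (Complex.abs_re_le_norm _).trans ?_
        rw [norm_mul, norm_neg]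
        gcongr
        exact h3.trans hCz
      have := (abs_le.1 h6).1
      linarith
    · refine h4.trans ?_
      have hn : (0 : ℝ) ≤ n := Nat.cast_nonneg n
      calc C * ‖q.1‖ ^ 2 ≤ C * (2 * b / (N + n)) ^ 2 := by gcongr
        _ = 4 * C * b ^ 2 * (1 / (N + n) ^ 2) := by
          rw [div_pow]
          ring
  have key : ∀ n : ℕ, (F^[n] p).1 ≠ 0 ∧ ‖(F^[n] p).2‖ ≤ R + 1 ∧
      (N + n) / 2 ≤ (-(α * (F^[n] p).1)⁻¹).re ∧ U p + n / 2 ≤ U (F^[n] p) ∧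
      ‖V (F^[n] p) - lam ^ n * V p‖ ≤ 4 * C * b ^ 2 * (1 / (N - 1) - 1 / (N + n - 1)) := by
    intro n
    induction n with
    | zero =>
      refine ⟨hp1, ?_, ?_, ?_, ?_⟩
      · simp only [Function.iterate_zero, id]
        linarith
      · simp only [Function.iterate_zero, id]
        push_cast
        linarith
      · simp
      · simp
    | succ n ih =>
      obtain ⟨i1, i2, i3, i4, i5⟩ := ih
      obtain ⟨s1, s2, s3, s4⟩ := one_step n _ i1 i2 i3
      rw [← Function.iterate_succ_apply' F n p] at s1 s2 s3 s4
      have hU' : U p + (n + 1 : ℕ) / 2 ≤ U (F^[n + 1] p) := by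
        push_cast
        linarith
      have hX : (N + (n + 1 : ℕ)) / 2 ≤ (-(α * (F^[n + 1] p).1)⁻¹).re := by
        have a1 := (abs_le.1 (hUX _ s2)).2
        have a2 := (abs_le.1 (hUX p (by linarith))).1
        push_cast at hU' ⊢
        linarith
      have hVn : ‖V (F^[n + 1] p) - lam ^ (n + 1) * V p‖ ≤
          4 * C * b ^ 2 * (1 / (N - 1) - 1 / (N + (n + 1 : ℕ) - 1)) := by
        have e : V (F^[n + 1] p) - lam ^ (n + 1) * V p =
            (V (F^[n + 1] p) - lam * V (F^[n] p)) + lam * (V (F^[n] p) - lam ^ n * V p) := by ring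
        rw [e]
        refine (norm_add_le _ _).trans ?_
        rw [norm_mul lam, hlam, one_mul]
        have ht := mul_le_mul_of_nonneg_left (inv_sq_le_telescope (by linarith : 1 < N) n)
          (by positivity : 0 ≤ 4 * C * b ^ 2)
        have := add_le_add (s4.trans ht) i5
        refine this.trans (le_of_eq ?_)
        ring
      refine ⟨s1, ?_, hX, hU', hVn⟩
      -- One step only gives the bound R + 2. The drift of V and the two corrections zψ, each at
      -- most 1/4, bring it back below R + 1.
      have e : (F^[n + 1] p).2 = (V (F^[n + 1] p) - lam ^ (n + 1) * V p) + lam ^ (n + 1) * p.2 +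
          lam ^ (n + 1) * (p.1 * ψ p.2) - (F^[n + 1] p).1 * ψ (F^[n + 1] p).2 := by
        simp only [hV]
        ring
      have hl : ‖lam ^ (n + 1)‖ = 1 := by rw [norm_pow, hlam, one_pow]
      have b1 : ‖V (F^[n + 1] p) - lam ^ (n + 1) * V p‖ ≤ 1 / 4 := by
        refine hVn.trans (le_trans ?_ hND)
        gcongr
        have hn : (0 : ℝ) ≤ (n + 1 : ℕ) := Nat.cast_nonneg _
        have : 0 ≤ 1 / (N + (n + 1 : ℕ) - 1) := by
          apply one_div_nonneg.2
          linarith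
        linarith
      have b2 : ‖(F^[n + 1] p).1 * ψ (F^[n + 1] p).2‖ ≤ 1 / 4 := by
        rw [norm_mul]
        refine le_trans ?_ hNQ
        gcongr
        · exact (hsmall _ _ hX).trans (hsmall' _)
        · exact hQ _ s2
      rw [e]
      refine (norm_sub_le _ _).trans ?_
      refine (add_le_add norm_add₃_le le_rfl).trans ?_
      rw [norm_mul (lam ^ (n + 1)), norm_mul (lam ^ (n + 1)), hl, one_mul, one_mul]
      linarith
  refine ⟨hpψ, fun n => ?_⟩
  obtain ⟨k1, k2, k3, k4, k5⟩ := key n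
  have hn : (0 : ℝ) ≤ n := Nat.cast_nonneg n
  have hNn : 0 < N + n := by linarith
  refine ⟨k1, k2, k3, ?_, ?_, ?_, ?_⟩
  · refine (hsmall n _ k3).trans ?_
    gcongr
    have : 0 ≤ 2 * b * Q + 4 * C * b ^ 2 := by positivity
    linarith
  · rw [norm_mul]
    calc ‖(F^[n] p).1‖ * ‖ψ (F^[n] p).2‖ ≤ 2 * b / (N + n) * Q := by
          gcongr
          · exact hsmall n _ k3
          · exact hQ _ (by linarith)
      _ = 2 * b * Q / (N + n) := by ring
      _ ≤ _ := by
          gcongr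
          have : 0 ≤ 2 * b + 4 * C * b ^ 2 := by positivity
          linarith
  · refine k5.trans (le_trans ?_ hND)
    gcongr
    have : 0 ≤ 1 / (N + n - 1) := by
      apply one_div_nonneg.2
      linarith
    linarith
  · have := (one_step n _ k1 k2 k3).2.2.2
    rw [← Function.iterate_succ_apply' F n p] at this
    refine this.trans ?_
    rw [mul_one_div]
    gcongr
    have : 0 ≤ 2 * b + 2 * b * Q := by positivity
    linarith

/-! ### Invariance of the Fatou set and of its components -/

theorem isOpen_fatouSet (F : ℂ × ℂ → ℂ × ℂ) : IsOpen (fatouSet F) := by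
  rw [isOpen_iff_forall_mem_open]
  rintro p ⟨U, hU, hp, hn⟩
  exact ⟨U, fun q hq => ⟨U, hU, hq, hn⟩, hU, hp⟩

theorem ConvergesOnCompacta.mono {G : ℕ → ℂ × ℂ → ℂ × ℂ} {U V : Set (ℂ × ℂ)}
    {h : ℂ × ℂ → OnePoint (ℂ × ℂ)} (hG : ConvergesOnCompacta G U h) (hVU : V ⊆ U) :
    ConvergesOnCompacta G V h := by
  rcases hG with ⟨h₀, hd, hu, he⟩ | ⟨hd, he⟩
  · exact .inl ⟨h₀, hd.mono hVU, fun K hK => hu K (hK.trans hVU), fun p hp => he p (hVU hp)⟩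
  · exact .inr ⟨fun K hK => hd K (hK.trans hVU), fun p hp => he p (hVU hp)⟩

theorem IteratesNormalOn.mono {F : ℂ × ℂ → ℂ × ℂ} {U V : Set (ℂ × ℂ)}
    (hF : IteratesNormalOn F U) (hVU : V ⊆ U) : IteratesNormalOn F V := by
  intro m
  obtain ⟨φ, hφ, h, hh⟩ := hF m
  exact ⟨φ, hφ, h, hh.mono hVU⟩

/-- A biholomorphic map commuting with `F` preserves the Fatou set. -/
theorem mem_fatouSet_of_commute {F H K : ℂ × ℂ → ℂ × ℂ} (hH : Differentiable ℂ H)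
    (hK : Differentiable ℂ K) (hKH : Function.LeftInverse K H) (hHK : Function.RightInverse K H)
    (hc : Function.Commute F H) {p : ℂ × ℂ} (hp : p ∈ fatouSet F) : H p ∈ fatouSet F := by
  obtain ⟨U, hU, hpU, hn⟩ := hp
  refine ⟨K ⁻¹' U, hU.preimage hK.continuous, by simpa [hKH p] using hpU, fun m => ?_⟩
  obtain ⟨φ, hφ, h, hh⟩ := hn m
  have hiter : ∀ n x, F^[n] x = H (F^[n] (K x)) := by
    intro n x
    rw [← (hc.iterate_left n).eq, hHK x]
  have himg : ∀ S ⊆ K ⁻¹' U, K '' S ⊆ U := fun S hS => Set.image_subset_iff.2 hS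
  rcases hh with ⟨h₀, hd, hu, -⟩ | ⟨hd, -⟩
  · refine ⟨φ, hφ, fun x => (H (h₀ (K x)) : ℂ × ℂ), .inl ⟨fun x => H (h₀ (K x)), ?_, ?_,
      fun _ _ => rfl⟩⟩
    · exact hH.comp_differentiableOn (hd.comp hK.differentiableOn fun _ hx => hx)
    · intro S hS hSc
      have hKc : IsCompact (K '' S) := hSc.image hK.continuous
      have hu1 := hu _ (himg S hS) hKc
      have hu2 : TendstoUniformlyOn (fun k x => F^[m (φ k)] (K x)) (fun x => h₀ (K x)) atTop S :=
        (hu1.comp K).mono (Set.subset_preimage_image K S)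
      -- `H` is uniformly continuous only on compacta; a compact neighbourhood of the limit image
      -- eventually contains the iterates.
      have hT : IsCompact (Metric.cthickening 1 (h₀ '' (K '' S))) :=
        (hKc.image_of_continuousOn (hd.continuousOn.mono (himg S hS))).cthickening
      have hmem : ∀ x ∈ S, h₀ (K x) ∈ h₀ '' (K '' S) := fun x hx => ⟨K x, ⟨x, hx, rfl⟩, rfl⟩
      have hH' := hT.uniformContinuousOn_of_continuous hH.continuous.continuousOn
      rw [Metric.tendstoUniformlyOn_iff] at hu2 ⊢
      rw [Metric.uniformContinuousOn_iff] at hH'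
      intro ε hε
      obtain ⟨δ, hδ, hδH⟩ := hH' ε hε
      filter_upwards [hu2 (min δ 1) (by positivity)] with k hk x hx
      rw [hiter]
      have hd' := hk x hx
      refine hδH _ (Metric.self_subset_cthickening _ (hmem x hx)) _ ?_
        (hd'.trans_le (min_le_left _ _))
      refine Metric.mem_cthickening_of_dist_le _ _ _ _ (hmem x hx) ?_
      rw [dist_comm]
      exact hd'.le.trans (min_le_right _ _)
  · refine ⟨φ, hφ, fun _ => OnePoint.infty, .inr ⟨?_, fun _ _ => rfl⟩⟩
    intro S hS hSc L hL
    filter_upwards [hd _ (himg S hS) (hSc.image hK.continuous) _ (hL.image hK.continuous)]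
      with k hk x hx hxL
    rw [hiter] at hxL
    exact hk (K x) ⟨x, hx, rfl⟩ ⟨_, hxL, hKH _⟩

theorem IsHolomorphicAutomorphism.image_fatouSet {F : ℂ × ℂ → ℂ × ℂ}
    (hF : IsHolomorphicAutomorphism F) : F '' fatouSet F = fatouSet F := by
  obtain ⟨hFd, G, hG, hl, hr⟩ := hF
  apply Set.Subset.antisymm
  · rintro _ ⟨p, hp, rfl⟩
    exact mem_fatouSet_of_commute hFd hG hl hr (Function.Commute.refl F) hp
  · intro p hp
    refine ⟨G p, mem_fatouSet_of_commute hG hFd hr hl (fun x => ?_) hp, hr p⟩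
    rw [hr x, hl x]

/-- A Fatou component containing a point and its image is invariant. -/
theorem IsHolomorphicAutomorphism.image_component_eq {F : ℂ × ℂ → ℂ × ℂ}
    (hF : IsHolomorphicAutomorphism F) {p q : ℂ × ℂ}
    (hq : q ∈ connectedComponentIn (fatouSet F) p)
    (hFq : F q ∈ connectedComponentIn (fatouSet F) p) :
    F '' connectedComponentIn (fatouSet F) p = connectedComponentIn (fatouSet F) p := by
  obtain ⟨hFd, G, hG, hl, hr⟩ := id hF
  let e : (ℂ × ℂ) ≃ₜ (ℂ × ℂ) := ⟨⟨F, G, hl, hr⟩, hFd.continuous, hG.continuous⟩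
  have hqf : q ∈ fatouSet F := connectedComponentIn_subset _ _ hq
  have h1 := e.image_connectedComponentIn hqf
  change F '' _ = connectedComponentIn (F '' fatouSet F) (F q) at h1
  rw [hF.image_fatouSet] at h1
  rw [connectedComponentIn_eq hq, h1, ← connectedComponentIn_eq hFq, connectedComponentIn_eq hq]

/-! ### Propagation of attraction inside the Fatou set -/

/-- The points with bounded forward orbit converging to the line `z = 0`. -/
def attractedSet (F : ℂ × ℂ → ℂ × ℂ) : Set (ℂ × ℂ) :=
  {p | Tendsto (fun n => (F^[n] p).1) atTop (𝓝 0) ∧ ∃ B : ℝ, ∀ n, ‖F^[n] p‖ ≤ B}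

theorem not_compactlyDivergesOn_of_bounded {F : ℂ × ℂ → ℂ × ℂ} {U : Set (ℂ × ℂ)} {m : ℕ → ℕ}
    {a : ℂ × ℂ} (ha : a ∈ U) {B : ℝ} (hB : ∀ n, ‖F^[n] a‖ ≤ B) :
    ¬ CompactlyDivergesOn (fun k => F^[m k]) U := by
  intro h
  obtain ⟨k, hk⟩ := (h {a} (by simpa using ha) isCompact_singleton (Metric.closedBall 0 B)
    (isCompact_closedBall _ _)).exists
  exact hk a rfl (by simpa using hB (m k))

/-- The bounded orbit of `a` rules out compact divergence. The first coordinate of the limit map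
vanishes near `a`, hence on the whole ball. -/
theorem exists_limit_of_normal_ball {F : ℂ × ℂ → ℂ × ℂ} {c : ℂ × ℂ} {r : ℝ}
    (hn : IteratesNormalOn F (Metric.ball c r)) {a : ℂ × ℂ} (ha : a ∈ Metric.ball c r)
    (haA : a ∈ interior (attractedSet F)) {q : ℂ × ℂ} (hq : q ∈ Metric.ball c r) (m : ℕ → ℕ) :
    ∃ φ : ℕ → ℕ, StrictMono φ ∧ ∃ x : ℂ × ℂ,
      Tendsto (fun k => F^[m (φ k)] q) atTop (𝓝 x) ∧ (Tendsto m atTop atTop → x.1 = 0) := by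
  obtain ⟨φ, hφ, h, hh⟩ := hn m
  refine ⟨φ, hφ, ?_⟩
  rcases hh with ⟨h₀, hd, hu, -⟩ | ⟨hd, -⟩
  · have hpt : ∀ x ∈ Metric.ball c r, Tendsto (fun k => F^[m (φ k)] x) atTop (𝓝 (h₀ x)) :=
      fun x hx => (hu {x} (by simpa using hx) isCompact_singleton).tendsto_at rfl
    refine ⟨h₀ q, hpt q hq, fun hm => ?_⟩
    refine eq_zero_on_ball_of_eventually_eq_zero (f := fun x => (h₀ x).1) hd.fst ha ?_ hq
    filter_upwards [mem_interior_iff_mem_nhds.1 haA, Metric.isOpen_ball.mem_nhds ha] with x hx hxb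
    have h1 := ((continuous_fst.tendsto _).comp (hpt x hxb))
    have h2 := hx.1.comp (hm.comp hφ.tendsto_atTop)
    exact tendsto_nhds_unique h1 h2
  · obtain ⟨B, hB⟩ := (interior_subset haA).2
    exact absurd hd (not_compactlyDivergesOn_of_bounded (m := fun k => m (φ k)) ha hB)

/-- If attraction or boundedness failed at `q`, a sequence of iterates witnessing it would have no
subsequence with the limit that normality provides. -/
theorem ball_subset_attractedSet {F : ℂ × ℂ → ℂ × ℂ} {c : ℂ × ℂ} {r : ℝ}
    (hn : IteratesNormalOn F (Metric.ball c r)) {a : ℂ × ℂ} (ha : a ∈ Metric.ball c r)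
    (haA : a ∈ interior (attractedSet F)) : Metric.ball c r ⊆ attractedSet F := by
  intro q hq
  constructor
  · by_contra hcon
    rw [Metric.tendsto_atTop] at hcon
    push Not at hcon
    obtain ⟨ε, hε, hcon⟩ := hcon
    choose m hm hmε using hcon
    obtain ⟨φ, hφ, x, hx, hx0⟩ := exists_limit_of_normal_ball hn ha haA hq m
    have hmt : Tendsto m atTop atTop := tendsto_atTop_mono hm tendsto_id
    have h1 := (continuous_fst.tendsto _).comp hx
    rw [hx0 hmt] at h1
    obtain ⟨k, hk⟩ := ((Metric.tendsto_nhds.1 h1) ε hε).exists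
    exact absurd hk (not_lt.2 (hmε (φ k)))
  · by_contra! hcon
    choose m hm using fun n : ℕ => hcon n
    obtain ⟨φ, hφ, x, hx, -⟩ := exists_limit_of_normal_ball hn ha haA hq m
    have h1 : ∀ᶠ k in atTop, ‖F^[m (φ k)] q‖ < ‖x‖ + 1 :=
      hx.norm.eventually (gt_mem_nhds (by linarith))
    obtain ⟨N, hN⟩ := exists_nat_gt (‖x‖ + 1)
    obtain ⟨k, hk, hkN⟩ := (h1.and (eventually_ge_atTop N)).exists
    have h2 := hm (φ k)
    have h3 : (N : ℝ) ≤ φ k := by exact_mod_cast hkN.trans (hφ.id_le k)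
    linarith

/-- A connected subset of the Fatou set that meets the interior of the attracted set lies in it. -/
theorem subset_interior_attractedSet {F : ℂ × ℂ → ℂ × ℂ} {Ω : Set (ℂ × ℂ)}
    (hΩ : IsPreconnected Ω) (hΩF : Ω ⊆ fatouSet F)
    (hne : (Ω ∩ interior (attractedSet F)).Nonempty) : Ω ⊆ interior (attractedSet F) := by
  refine hΩ.subset_of_closure_inter_subset isOpen_interior hne ?_
  rintro p ⟨hpc, hpΩ⟩
  obtain ⟨U, hU, hpU, hn⟩ := hΩF hpΩ
  obtain ⟨r, hr, hrU⟩ := Metric.isOpen_iff.1 hU p hpU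
  obtain ⟨a, ha, haA⟩ := mem_closure_iff.1 hpc _ Metric.isOpen_ball (Metric.mem_ball_self hr)
  rw [mem_interior_iff_mem_nhds]
  exact mem_of_superset (Metric.ball_mem_nhds p hr)
    (ball_subset_attractedSet (hn.mono hrU) ha haA)

/-! ### The transversal derivative along z = 0 -/

theorem HasForm.exists_norm_fst_sub_le {F : ℂ × ℂ → ℂ × ℂ} {lam : ℂ} {f g : ℂ → ℂ}
    (hF : Differentiable ℂ F) (hf : Differentiable ℂ f) (hform : HasForm F lam f g) (R : ℝ) :
    ∃ C : ℝ, 0 ≤ C ∧ ∀ p : ℂ × ℂ, ‖p.1‖ ≤ 1 → ‖p.2‖ ≤ R → ‖(F p).1 - p.1‖ ≤ C * ‖p.1‖ ^ 2 := by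
  obtain ⟨C, hC0, hC⟩ := exists_norm_le_pow_of_isBigO (by fun_prop) 3 hform.1 R
  obtain ⟨A, hA0, hA⟩ := exists_bound_on_disc hf.continuous R
  refine ⟨C + A, by positivity, fun p hp1 hp2 => ?_⟩
  have h1 := hC p.1 p.2 hp1 hp2
  simp only [Prod.mk.eta] at h1
  have h2 : ‖f p.2 * p.1 ^ 2‖ ≤ A * ‖p.1‖ ^ 2 := by
    rw [norm_mul, norm_pow]
    gcongr
    exact hA _ hp2
  have h3 : C * ‖p.1‖ ^ 3 ≤ C * ‖p.1‖ ^ 2 :=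
    mul_le_mul_of_nonneg_left (pow_le_pow_of_le_one (norm_nonneg _) hp1 (by norm_num)) hC0
  have e : (F p).1 - p.1 = ((F p).1 - (p.1 + f p.2 * p.1 ^ 2)) + f p.2 * p.1 ^ 2 := by ring
  rw [e]
  refine (norm_add_le _ _).trans ?_
  linarith

/-- The first coordinate of F is z + O(z²) along the whole line, which is therefore invariant, and
the chain rule applies. -/
theorem HasForm.hasFDerivAt_iterate_fst {F : ℂ × ℂ → ℂ × ℂ} {lam : ℂ} {f g : ℂ → ℂ}
    (hF : Differentiable ℂ F) (hf : Differentiable ℂ f) (hform : HasForm F lam f g) (w : ℂ)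
    (n : ℕ) : (F^[n] (0, w)).1 = 0 ∧ HasFDerivAt (fun p => (F^[n] p).1)
      (ContinuousLinearMap.fst ℂ ℂ ℂ) (0, w) := by
  have hone : ∀ w : ℂ, HasFDerivAt (fun p => (F p).1) (ContinuousLinearMap.fst ℂ ℂ ℂ) (0, w) := by
    intro w
    obtain ⟨C, hC0, hC⟩ := hform.exists_norm_fst_sub_le hF hf (‖w‖ + 1)
    have h0 : (F (0, w)).1 = 0 := by simpa using hC (0, w) (by simp) (by simp)
    rw [hasFDerivAt_iff_isLittleO]
    have hb : (fun p : ℂ × ℂ => (F p).1 - (F (0, w)).1 -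
        ContinuousLinearMap.fst ℂ ℂ ℂ (p - (0, w))) =O[𝓝 (0, w)]
        fun p => ‖p - ((0 : ℂ), w)‖ ^ 2 := by
      refine Asymptotics.IsBigO.of_bound C ?_
      filter_upwards [Metric.ball_mem_nhds ((0 : ℂ), w) one_pos] with p hp
      have hle1 : ‖p.1‖ ≤ ‖p - ((0 : ℂ), w)‖ := by simpa using norm_fst_le (p - ((0 : ℂ), w))
      have hle2 : ‖p.2 - w‖ ≤ ‖p - ((0 : ℂ), w)‖ := by simpa using norm_snd_le (p - ((0 : ℂ), w))
      rw [mem_ball_iff_norm] at hp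
      have := norm_sub_norm_le p.2 w
      have h1 := hC p (by linarith) (by linarith)
      have e : (F p).1 - (F (0, w)).1 - ContinuousLinearMap.fst ℂ ℂ ℂ (p - (0, w)) =
          (F p).1 - p.1 := by simp [h0]
      rw [e]
      refine h1.trans ?_
      rw [norm_pow, norm_norm]
      gcongr
    refine hb.trans_isLittleO ?_
    have := Asymptotics.isLittleO_pow_sub_sub ((0 : ℂ), w) (m := 2) (by norm_num)
    exact this
  induction n with
  | zero => exact ⟨rfl, by simpa using (ContinuousLinearMap.fst ℂ ℂ ℂ).hasFDerivAt⟩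
  | succ n ih =>
    obtain ⟨ih0, ih1⟩ := ih
    have hit : DifferentiableAt ℂ F^[n] (0, w) := (hF.iterate n) _
    have hpt : F^[n] (0, w) = (0, (F^[n] (0, w)).2) := Prod.ext ih0 rfl
    obtain ⟨C, hC0, hC⟩ := hform.exists_norm_fst_sub_le hF hf ‖(F^[n] (0, w)).2‖
    constructor
    · have := hC (F^[n] (0, w)) (by rw [ih0]; simp) le_rfl
      rw [Function.iterate_succ_apply']
      simpa [ih0] using this
    · have h1 := hone (F^[n] (0, w)).2
      rw [← hpt] at h1
      have h2 := h1.comp (0, w) hit.hasFDerivAt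
      have h3 := (ContinuousLinearMap.fst ℂ ℂ ℂ).hasFDerivAt.comp ((0 : ℂ), w) hit.hasFDerivAt
      -- By uniqueness of derivatives, `fst` composed with the derivative of the n-th iterate is
      -- again `fst`.
      have h4 := ih1.unique h3
      rw [← h4] at h2
      simpa only [Function.iterate_succ', Function.comp_def] using h2

/-- The derivative of the iterates transversally to the line `z = 0` is `1`, so no Fatou point on
the line is interior to the attracted set. -/
theorem HasForm.zero_prod_notMem {F : ℂ × ℂ → ℂ × ℂ} {lam : ℂ} {f g : ℂ → ℂ}
    (hF : Differentiable ℂ F) (hf : Differentiable ℂ f) (hform : HasForm F lam f g) {w : ℂ}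
    (hw : ((0 : ℂ), w) ∈ fatouSet F) : ((0 : ℂ), w) ∉ interior (attractedSet F) := by
  intro hA
  obtain ⟨U, hU, hpU, hn⟩ := hw
  obtain ⟨r, hr, hrU⟩ := Metric.isOpen_iff.1 (hU.inter isOpen_interior) _ ⟨hpU, hA⟩
  obtain ⟨φ, hφ, h, hh⟩ := hn id
  rcases hh with ⟨h₀, hd, hu, -⟩ | ⟨hd, -⟩
  · have hsub : Metric.closedBall ((0 : ℂ), w) (r / 2) ⊆ Metric.ball ((0 : ℂ), w) r :=
      Metric.closedBall_subset_ball (by linarith)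
    have hunif := hu (Metric.closedBall ((0 : ℂ), w) (r / 2))
      (hsub.trans (hrU.trans Set.inter_subset_left)) (isCompact_closedBall _ _)
    have hzero : ∀ x ∈ Metric.closedBall ((0 : ℂ), w) (r / 2), (h₀ x).1 = 0 := by
      intro x hx
      have h1 := (continuous_fst.tendsto _).comp (hunif.tendsto_at hx)
      have h2 := (interior_subset (hrU (hsub hx)).2).1.comp hφ.tendsto_atTop
      exact tendsto_nhds_unique h1 h2
    rw [Metric.tendstoUniformlyOn_iff] at hunif
    -- A bound r/4 on a circle of radius r/2 would force the derivative 1 to be at most 1/2.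
    obtain ⟨k, hk⟩ := (hunif (r / 4) (by positivity)).exists
    have hs : Differentiable ℂ fun ζ : ℂ => (F^[φ k] (ζ, w)).1 := by
      have := hF.iterate (φ k)
      fun_prop
    have hder : HasDerivAt (fun ζ : ℂ => (F^[φ k] (ζ, w)).1) 1 0 := by
      have h1 := (hform.hasFDerivAt_iterate_fst hF hf w (φ k)).2
      have h2 : HasDerivAt (fun ζ : ℂ => (ζ, w)) (1, 0) 0 :=
        (hasDerivAt_id (0 : ℂ)).prodMk (hasDerivAt_const _ _)
      exact h1.comp_hasDerivAt (0 : ℂ) h2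
    have hest := Complex.norm_deriv_le_of_forall_mem_sphere_norm_le (c := 0) (C := r / 4)
      (half_pos hr) hs.diffContOnCl (fun ζ hζ => by
        have hm : (ζ, w) ∈ Metric.closedBall ((0 : ℂ), w) (r / 2) := by
          have : ‖ζ‖ = r / 2 := by simpa using hζ
          rw [mem_closedBall_iff_norm]
          simp [this, hr.le, div_nonneg]
        have h1 := hk _ hm
        rw [dist_eq_norm] at h1
        have h2 := (norm_fst_le _).trans h1.le
        rwa [Prod.fst_sub, hzero _ hm, zero_sub, norm_neg] at h2)
    rw [hder.deriv, norm_one, le_div_iff₀ (by positivity)] at hest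
    linarith
  · obtain ⟨B, hB⟩ := (interior_subset hA).2
    exact not_compactlyDivergesOn_of_bounded (m := fun k => id (φ k)) hpU hB hd

/-! ### Convergence of the rotated iterates on a petal -/

/-- On a thin petal, `lam ^ (-n) * w_n` converges uniformly, to a function close to `w`. -/
theorem HasStepEstimates.exists_petal_limit {F : ℂ × ℂ → ℂ × ℂ} {lam α : ℂ} {φ ψ : ℂ → ℂ}
    (h : HasStepEstimates F lam α φ ψ) (hlam : ‖lam‖ = 1) (hα : α ≠ 0)
    (hφ : Continuous φ) (hψ : Continuous ψ) (R : ℝ) :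
    ∃ (M : ℝ) (v : ℂ × ℂ → ℂ), 0 < M ∧
      TendstoUniformlyOn (fun n p => (F^[n] p).1) (fun _ => 0) atTop (petal α R M) ∧
      TendstoUniformlyOn (fun n p => lam⁻¹ ^ n * (F^[n] p).2) v atTop (petal α R M) ∧
      ∀ p ∈ petal α R M, ‖v p - p.2‖ ≤ 1 / 2 ∧ (∀ n, ‖(F^[n] p).2‖ ≤ R + 1) ∧
        Tendsto (fun n => (-(α * (F^[n] p).1)⁻¹).re) atTop atTop := by
  obtain ⟨M, N, D, hM, hN, hD, horb⟩ := h.orbit hlam hα hφ hψ R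
  have hlam0 : lam ≠ 0 := norm_pos_iff.1 (by rw [hlam]; exact one_pos)
  have hnl : ∀ n : ℕ, ‖lam⁻¹ ^ n‖ = 1 := fun n => by rw [norm_pow, norm_inv, hlam, inv_one, one_pow]
  have hnat : Tendsto (fun n : ℕ => N + (n : ℝ)) atTop atTop :=
    tendsto_atTop_add_const_left _ _ tendsto_natCast_atTop_atTop
  have hD0 : Tendsto (fun n : ℕ => D / (N + n)) atTop (𝓝 0) := hnat.const_div_atTop D
  set V : ℂ × ℂ → ℂ := fun q => q.2 + q.1 * ψ q.2 with hV
  set G : ℕ → ℂ × ℂ → ℂ := fun n p => lam⁻¹ ^ n * V (F^[n] p) with hG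
  have hsum : Summable fun n : ℕ => D / (N + n) ^ 2 := by
    have h1 : Summable fun n : ℕ => D * (1 / ((n + 1 : ℕ) : ℝ) ^ 2) :=
      ((summable_nat_add_iff 1).2 (Real.summable_one_div_nat_pow.2 one_lt_two)).mul_left D
    refine h1.of_nonneg_of_le (fun n => by positivity) fun n => ?_
    have hn : (0 : ℝ) ≤ n := Nat.cast_nonneg n
    rw [mul_one_div]
    push_cast
    exact div_le_div_of_nonneg_left hD (by positivity)
      (pow_le_pow_left₀ (by positivity) (by linarith) 2)
  have hdiff : ∀ n : ℕ, ∀ p ∈ petal α R M, ‖G (n + 1) p - G n p‖ ≤ D / (N + n) ^ 2 := by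
    intro n p hp
    have e : G (n + 1) p - G n p =
        lam⁻¹ ^ (n + 1) * (V (F^[n + 1] p) - lam * V (F^[n] p)) := by
      simp only [hG]
      rw [mul_sub, ← mul_assoc, pow_succ, mul_assoc (lam⁻¹ ^ n) lam⁻¹ lam, inv_mul_cancel₀ hlam0,
        mul_one]
    rw [e, norm_mul, hnl, one_mul]
    exact ((horb p hp).2 n).2.2.2.2.2.2
  set T : ℂ × ℂ → ℂ := fun p => ∑' n, (G (n + 1) p - G n p) with hT
  have hunif : TendstoUniformlyOn (fun n p => G n p - G 0 p) T atTop (petal α R M) :=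
    (tendstoUniformlyOn_tsum_nat hsum hdiff).congr
      (Eventually.of_forall fun n p _ => Finset.sum_range_sub (fun n => G n p) n)
  -- The correction zψ(w) tends to 0 uniformly, so w_n and V have the same rotated limit.
  have hw : TendstoUniformlyOn (fun n p => lam⁻¹ ^ n * (F^[n] p).2) (fun p => G 0 p + T p) atTop
      (petal α R M) := by
    rw [Metric.tendstoUniformlyOn_iff] at hunif ⊢
    intro ε hε
    filter_upwards [hunif (ε / 2) (half_pos hε), hD0.eventually (gt_mem_nhds (half_pos hε))]
      with n h1 h2 p hp
    have h3 := h1 p hp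
    have h4 := (((horb p hp).2 n).2.2.2.2.1).trans_lt h2
    rw [dist_eq_norm] at h3 ⊢
    have e : G 0 p + T p - lam⁻¹ ^ n * (F^[n] p).2 =
        (T p - (G n p - G 0 p)) + lam⁻¹ ^ n * ((F^[n] p).1 * ψ (F^[n] p).2) := by
      simp only [hG, hV]
      ring
    rw [e]
    refine (norm_add_le _ _).trans_lt ?_
    rw [norm_mul (lam⁻¹ ^ n), hnl, one_mul]
    linarith
  refine ⟨M, fun p => G 0 p + T p, hM, ?_, hw, fun p hp => ⟨?_, fun n => ((horb p hp).2 n).2.1, ?_⟩⟩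
  · rw [Metric.tendstoUniformlyOn_iff]
    intro ε hε
    filter_upwards [hD0.eventually (gt_mem_nhds hε)] with n hn p hp
    rw [dist_zero_left]
    exact (((horb p hp).2 n).2.2.2.1).trans_lt hn
  · have h1 : Tendsto (fun n => ‖G n p - G 0 p‖) atTop (𝓝 ‖T p‖) :=
      (hunif.tendsto_at hp).norm
    have h2 : ‖T p‖ ≤ 1 / 4 := by
      refine le_of_tendsto' h1 fun n => ?_
      have e : G n p - G 0 p = lam⁻¹ ^ n * (V (F^[n] p) - lam ^ n * V p) := by
        simp only [hG, mul_sub, ← mul_assoc, ← mul_pow, inv_mul_cancel₀ hlam0, one_pow, one_mul,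
          pow_zero, Function.iterate_zero, id]
      rw [e, norm_mul, hnl, one_mul]
      exact ((horb p hp).2 n).2.2.2.2.2.1
    have e : G 0 p + T p - p.2 = p.1 * ψ p.2 + T p := by
      simp only [hG, hV, pow_zero, Function.iterate_zero, id]
      ring
    rw [e]
    refine (norm_add_le _ _).trans ?_
    linarith [(horb p hp).1]
  · exact tendsto_atTop_mono (fun n => ((horb p hp).2 n).2.2.1)
      (hnat.atTop_div_const two_pos)

/-! ### Topology of petals -/

theorem isOpen_petal {α : ℂ} (hα : α ≠ 0) {R M : ℝ} (hM : 0 ≤ M) : IsOpen (petal α R M) := by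
  rw [isOpen_iff_mem_nhds]
  rintro p ⟨h1, h2⟩
  have hp : p.1 ≠ 0 := ne_zero_of_lt_re_inv hM h2
  have hc1 : ContinuousAt (fun q : ℂ × ℂ => ‖q.2‖) p := by fun_prop
  have hc2 : ContinuousAt (fun q : ℂ × ℂ => (-(α * q.1)⁻¹).re) p := by
    refine Complex.continuous_re.continuousAt.comp (ContinuousAt.neg (ContinuousAt.inv₀ ?_ ?_))
    · fun_prop
    · exact mul_ne_zero hα hp
  exact (hc1.eventually (gt_mem_nhds h1)).and (hc2.eventually (lt_mem_nhds h2))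

theorem neg_inv_mul_neg_inv_mul {α : ℂ} (hα : α ≠ 0) (x : ℂ) : -(α * -(α * x)⁻¹)⁻¹ = x := by
  rw [mul_inv α x, mul_neg, ← mul_assoc, mul_inv_cancel₀ hα, one_mul, inv_neg, neg_neg, inv_inv]

/-- The involution z ↦ −1/(αz) carries a half-plane times a disc, which is connected, onto the
petal. -/
theorem isPreconnected_petal {α : ℂ} (hα : α ≠ 0) {R M : ℝ} (hM : 0 ≤ M) :
    IsPreconnected (petal α R M) := by
  have hc : IsPreconnected ({x : ℂ | M < x.re} ×ˢ Metric.ball (0 : ℂ) R) :=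
    (convex_halfSpace_re_gt M).isPreconnected.prod (convex_ball _ _).isPreconnected
  have hco : ContinuousOn (fun q : ℂ × ℂ => (-(α * q.1)⁻¹, q.2))
      ({x : ℂ | M < x.re} ×ˢ Metric.ball (0 : ℂ) R) := by
    refine ContinuousOn.prodMk (ContinuousOn.neg (ContinuousOn.inv₀ (by fun_prop) ?_)) (by fun_prop)
    rintro q ⟨hq, -⟩ h0
    rcases mul_eq_zero.1 h0 with h | h
    · exact hα h
    · have hq' : M < q.1.re := hq
      rw [h, Complex.zero_re] at hq'
      linarith
  convert hc.image _ hco using 1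
  ext p
  constructor
  · rintro ⟨h1, h2⟩
    exact ⟨(-(α * p.1)⁻¹, p.2), ⟨h2, by simpa using h1⟩,
      Prod.ext (neg_inv_mul_neg_inv_mul hα p.1) rfl⟩
  · rintro ⟨q, ⟨h1, h2⟩, rfl⟩
    refine ⟨by simpa using h2, ?_⟩
    simp only [neg_inv_mul_neg_inv_mul hα]
    exact h1

theorem mk_mem_petal {α : ℂ} (hα : α ≠ 0) {R M t : ℝ} {w : ℂ} (hw : ‖w‖ < R) (ht : M < t) :
    ((-(α * (t : ℂ))⁻¹, w) : ℂ × ℂ) ∈ petal α R M := by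
  refine ⟨hw, ?_⟩
  simp only [neg_inv_mul_neg_inv_mul hα, Complex.ofReal_re]
  exact ht

/-! ### Normality on petals and surjectivity of the limits -/

/-- Subsequences of the iterates along which `lam ^ n` converges are uniformly convergent. -/
theorem tendstoUniformlyOn_iterate_subseq {F : ℂ × ℂ → ℂ × ℂ} {lam : ℂ} (hlam : ‖lam‖ = 1)
    {S : Set (ℂ × ℂ)} {v : ℂ × ℂ → ℂ} {B : ℝ} (hB : ∀ p ∈ S, ‖v p‖ ≤ B)
    (hz : TendstoUniformlyOn (fun n p => (F^[n] p).1) (fun _ => 0) atTop S)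
    (hw : TendstoUniformlyOn (fun n p => lam⁻¹ ^ n * (F^[n] p).2) v atTop S)
    {m : ℕ → ℕ} (hm : Tendsto m atTop atTop) {μ : ℂ}
    (hμ : Tendsto (fun k => lam ^ m k) atTop (𝓝 μ)) :
    TendstoUniformlyOn (fun k => F^[m k]) (fun p => (0, μ * v p)) atTop S := by
  have hlam0 : lam ≠ 0 := norm_pos_iff.1 (by rw [hlam]; exact one_pos)
  rw [Metric.tendstoUniformlyOn_iff] at hz hw ⊢
  intro ε hε
  have hB1 : 0 < |B| + 1 := by positivity
  filter_upwards [hm.eventually (hz ε hε), hm.eventually (hw (ε / 2) (half_pos hε)),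
    (Metric.tendsto_nhds.1 hμ) (ε / 2 / (|B| + 1)) (by positivity)] with k h1 h2 h3 p hp
  rw [Prod.dist_eq, max_lt_iff]
  refine ⟨h1 p hp, ?_⟩
  have h4 := h2 p hp
  rw [dist_eq_norm] at h3 h4 ⊢
  have e : μ * v p - (F^[m k] p).2 = lam ^ m k * (v p - lam⁻¹ ^ m k * (F^[m k] p).2) -
      (lam ^ m k - μ) * v p := by
    have : lam ^ m k * lam⁻¹ ^ m k = 1 := by rw [← mul_pow, mul_inv_cancel₀ hlam0, one_pow]
    linear_combination (F^[m k] p).2 * this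
  rw [e]
  refine (norm_sub_le _ _).trans_lt ?_
  rw [norm_mul, norm_mul, norm_pow, hlam, one_pow, one_mul]
  have h5 : ‖lam ^ m k - μ‖ * ‖v p‖ ≤ ε / 2 := by
    calc ‖lam ^ m k - μ‖ * ‖v p‖ ≤ ε / 2 / (|B| + 1) * (|B| + 1) := by
          gcongr
          exact (hB p hp).trans ((le_abs_self B).trans (by linarith))
      _ = ε / 2 := by field_simp
  linarith

/-- Normality is required of arbitrary sequences of iterates, so exponents that do not tend to
infinity must be handled too. -/
theorem exists_subseq_const_or_tendsto (m : ℕ → ℕ) :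
    ∃ φ : ℕ → ℕ, StrictMono φ ∧ ((∃ N, ∀ k, m (φ k) = N) ∨ Tendsto (m ∘ φ) atTop atTop) := by
  by_cases h : ∃ N, ∃ᶠ k in atTop, m k = N
  · obtain ⟨N, hN⟩ := h
    obtain ⟨φ, hφ, hφN⟩ := extraction_of_frequently_atTop hN
    exact ⟨φ, hφ, .inl ⟨N, hφN⟩⟩
  · push Not at h
    refine ⟨id, strictMono_id, .inr (tendsto_atTop.2 fun b => ?_)⟩
    have := (Finset.range b).eventually_all.2 fun N _ => h N
    filter_upwards [this] with k hk
    by_contra hlt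
    exact hk (m k) (Finset.mem_range.2 (not_le.1 hlt)) rfl

theorem exists_subseq_pow_tendsto {lam : ℂ} (hlam : ‖lam‖ = 1) (m : ℕ → ℕ) :
    ∃ φ : ℕ → ℕ, StrictMono φ ∧ ∃ μ : ℂ, ‖μ‖ = 1 ∧
      Tendsto (fun k => lam ^ m (φ k)) atTop (𝓝 μ) := by
  obtain ⟨μ, hμ, φ, hφ, h⟩ := (isCompact_sphere (0 : ℂ) 1).tendsto_subseq
    (x := fun k => lam ^ m k) (fun k => by simp [hlam])
  exact ⟨φ, hφ, μ, by simpa using hμ, h⟩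

theorem iteratesNormalOn_of_tendstoUniformlyOn {F : ℂ × ℂ → ℂ × ℂ} (hF : Differentiable ℂ F)
    {lam : ℂ} (hlam : ‖lam‖ = 1) {S : Set (ℂ × ℂ)} {v : ℂ × ℂ → ℂ}
    (hv : DifferentiableOn ℂ v S) {B : ℝ} (hB : ∀ p ∈ S, ‖v p‖ ≤ B)
    (hz : TendstoUniformlyOn (fun n p => (F^[n] p).1) (fun _ => 0) atTop S)
    (hw : TendstoUniformlyOn (fun n p => lam⁻¹ ^ n * (F^[n] p).2) v atTop S) :
    IteratesNormalOn F S := by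
  intro m
  obtain ⟨φ, hφ, ⟨N, hN⟩ | ht⟩ := exists_subseq_const_or_tendsto m
  · refine ⟨φ, hφ, fun p => (F^[N] p : ℂ × ℂ), .inl ⟨F^[N], (hF.iterate N).differentiableOn,
      fun K _ _ => ?_, fun _ _ => rfl⟩⟩
    simp only [hN]
    rw [Metric.tendstoUniformlyOn_iff]
    intro ε hε
    simp [hε]
  · obtain ⟨χ, hχ, μ, -, hμ⟩ := exists_subseq_pow_tendsto hlam (m ∘ φ)
    refine ⟨φ ∘ χ, hφ.comp hχ, fun p => ((0, μ * v p) : ℂ × ℂ),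
      .inl ⟨fun p => (0, μ * v p), ?_, fun K hK _ => ?_, fun _ _ => rfl⟩⟩
    · exact (differentiableOn_const _).prodMk (hv.const_mul μ)
    · exact (tendstoUniformlyOn_iterate_subseq hlam hB hz hw (ht.comp hχ.tendsto_atTop) hμ).mono hK

/-- A holomorphic function on a disc that is close to the identity takes all values in a smaller
disc. -/
theorem exists_eq_of_norm_sub_le {s : ℂ → ℂ} {R : ℝ} (hs : DifferentiableOn ℂ s (Metric.ball 0 R))
    (hb : ∀ w ∈ Metric.ball (0 : ℂ) R, ‖s w - w‖ ≤ 1 / 2) {a : ℂ} (ha : 4 * ‖a‖ + 4 < R) :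
    ∃ w ∈ Metric.ball (0 : ℂ) R, s w = a := by
  have hR : 0 < R := by linarith [norm_nonneg a]
  have hsub : Metric.closedBall (0 : ℂ) (R / 2) ⊆ Metric.ball 0 R :=
    Metric.closedBall_subset_ball (by linarith)
  have h0 := hb 0 (Metric.mem_ball_self hR)
  rw [sub_zero] at h0
  have hsph : ∀ w ∈ Metric.sphere (0 : ℂ) (R / 2), R / 2 - 1 ≤ ‖s w - s 0‖ := by
    intro w hw
    have h1 := hb w (hsub (Metric.sphere_subset_closedBall hw))
    have h2 : ‖w‖ = R / 2 := by simpa using hw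
    have h3 : ‖w‖ ≤ ‖s w - s 0‖ + ‖s w - w‖ + ‖s 0‖ := by
      have e : w = (s w - s 0) - (s w - w) + s 0 := by ring
      calc ‖w‖ = ‖(s w - s 0) - (s w - w) + s 0‖ := by rw [← e]
        _ ≤ _ := (norm_add_le _ _).trans (by gcongr; exact norm_sub_le _ _)
    linarith
  have hne : ∃ᶠ w in 𝓝 (0 : ℂ), s w ≠ s 0 := by
    intro hcon
    have hev : s =ᶠ[𝓝 0] fun _ => s 0 := by
      filter_upwards [hcon] with w hw
      exact not_not.1 hw
    have heq := (hs.analyticOnNhd Metric.isOpen_ball).eqOn_of_preconnected_of_eventuallyEq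
      analyticOnNhd_const (convex_ball (0 : ℂ) R).isPreconnected (Metric.mem_ball_self hR) hev
    have hm : ((R / 2 : ℝ) : ℂ) ∈ Metric.sphere (0 : ℂ) (R / 2) := by
      rw [mem_sphere_zero_iff_norm, Complex.norm_real, Real.norm_of_nonneg (by positivity)]
    have h1 := hsph _ hm
    rw [heq (hsub (Metric.sphere_subset_closedBall hm)), sub_self, norm_zero] at h1
    linarith [norm_nonneg a]
  have := ((hs.mono hsub).diffContOnCl_ball subset_rfl).ball_subset_image_closedBall
    (half_pos hR) hsph hne
  -- The quantitative open mapping theorem covers the disc of radius R/4 − 1/2 about s(0). Since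
  -- ‖s(0)‖ ≤ 1/2, it contains `a` as soon as R > 4‖a‖ + 4.
  obtain ⟨w, hw, hwa⟩ := this (show a ∈ Metric.ball (s 0) ((R / 2 - 1) / 2) by
    rw [mem_ball_iff_norm]
    have := norm_sub_le a (s 0)
    linarith)
  exact ⟨w, hsub hw, hwa⟩

/-- A family of thin petals over larger and larger discs, on which the iterates of `F` converge to
the line `z = 0`, up to rotation. -/
theorem exists_petals {F : ℂ × ℂ → ℂ × ℂ} {lam α : ℂ} {φ ψ : ℂ → ℂ} (hF : Differentiable ℂ F)
    (h : HasStepEstimates F lam α φ ψ) (hlam : ‖lam‖ = 1) (hα : α ≠ 0)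
    (hφ : Continuous φ) (hψ : Continuous ψ) :
    ∃ (M : ℕ → ℝ) (v : ℕ → ℂ × ℂ → ℂ), ∀ R : ℕ, 0 < M R ∧
      TendstoUniformlyOn (fun n p => (F^[n] p).1) (fun _ => 0) atTop (petal α R (M R)) ∧
      TendstoUniformlyOn (fun n p => lam⁻¹ ^ n * (F^[n] p).2) (v R) atTop (petal α R (M R)) ∧
      DifferentiableOn ℂ (v R) (petal α R (M R)) ∧
      ∀ p ∈ petal α R (M R), ‖v R p - p.2‖ ≤ 1 / 2 ∧ ‖v R p‖ ≤ R + 1 ∧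
        (∀ n, ‖(F^[n] p).2‖ ≤ R + 1) ∧
        Tendsto (fun n => (-(α * (F^[n] p).1)⁻¹).re) atTop atTop := by
  choose M v hM hz hw hp using fun R : ℕ => h.exists_petal_limit hlam hα hφ hψ (R : ℝ)
  refine ⟨M, v, fun R => ⟨hM R, hz R, hw R, ?_, fun p hpR => ?_⟩⟩
  · refine TendstoUniformlyOn.differentiableOn_of_isOpen (isOpen_petal hα (hM R).le)
      (fun n => ?_) (hw R)
    exact ((hF.iterate n).snd.const_mul _).differentiableOn
  · obtain ⟨h1, h2, h3⟩ := hp R p hpR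
    refine ⟨h1, ?_, h2, h3⟩
    have h4 := norm_sub_norm_le (v R p) p.2
    have h5 : ‖p.2‖ < R := hpR.1
    linarith

theorem petal_subset_attractedSet {F : ℂ × ℂ → ℂ × ℂ} {S : Set (ℂ × ℂ)} {R : ℝ}
    (hz : TendstoUniformlyOn (fun n p => (F^[n] p).1) (fun _ => 0) atTop S)
    (hw : ∀ p ∈ S, ∀ n, ‖(F^[n] p).2‖ ≤ R) : S ⊆ attractedSet F := by
  intro p hp
  have h1 := hz.tendsto_at hp
  refine ⟨h1, ?_⟩
  obtain ⟨B, hB⟩ := h1.norm.bddAbove_range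
  exact ⟨max B R, fun n => max_le_max (hB ⟨n, rfl⟩) (hw p hp n)⟩

/-! ### Limit maps and the ω-limit set -/

theorem mem_wAxis {p : ℂ × ℂ} : p ∈ wAxis ↔ p.1 = 0 := by simp [wAxis]

/-- The `ω`-limit set of an attracted set on which the points of the line `z = 0` are limits along
subsequences of the iterates. -/
theorem omegaLimitOn_eq_wAxis {F : ℂ × ℂ → ℂ × ℂ} {Ω : Set (ℂ × ℂ)}
    (hA : Ω ⊆ attractedSet F)
    (hlim : ∀ m : ℕ → ℕ, StrictMono m → ∀ a : ℂ, ∃ p ∈ Ω, ∃ χ : ℕ → ℕ, StrictMono χ ∧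
      Tendsto (fun k => F^[m (χ k)] p) atTop (𝓝 (0, a))) :
    omegaLimitOn F Ω = wAxis := by
  apply Set.Subset.antisymm
  · intro q hq
    simp only [omegaLimitOn, Set.mem_iUnion] at hq
    obtain ⟨p, hp, hq⟩ := hq
    rw [mem_omegaLimit_iff_frequently] at hq
    rw [mem_wAxis]
    by_contra hne
    have hpos : 0 < ‖q.1‖ := norm_pos_iff.2 hne
    have hnear : {x : ℂ × ℂ | ‖q.1‖ / 2 < ‖x.1‖} ∈ 𝓝 q :=
      (continuous_fst.norm.continuousAt (x := q)).eventually (lt_mem_nhds (half_lt_self hpos))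
    have h1 : ∀ᶠ n in atTop, ‖(F^[n] p).1‖ < ‖q.1‖ / 2 := by
      have := (hA hp).1.norm
      rw [norm_zero] at this
      exact this.eventually (gt_mem_nhds (half_pos hpos))
    obtain ⟨n, ⟨x, hx, hxn⟩, hn⟩ := ((hq _ hnear).and_eventually h1).exists
    rw [Set.mem_singleton_iff] at hx
    subst hx
    exact absurd hn (not_lt.2 (le_of_lt hxn))
  · intro q hq
    rw [mem_wAxis] at hq
    obtain ⟨p, hp, χ, hχ, hpχ⟩ := hlim id strictMono_id q.2
    simp only [omegaLimitOn, Set.mem_iUnion]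
    refine ⟨p, hp, ?_⟩
    rw [mem_omegaLimit_iff_frequently]
    intro S hS
    have hq' : q = (0, q.2) := Prod.ext hq rfl
    rw [hq'] at hS
    refine hχ.tendsto_atTop.frequently (Eventually.frequently ?_)
    filter_upwards [hpχ hS] with k hk
    exact ⟨p, rfl, hk⟩

/-- The point p may depend on the sequence m: convergence along m itself forces the limit map to
agree with any subsequential limit at p. -/
theorem image_limitMap_eq {F : ℂ × ℂ → ℂ × ℂ} {Ω : Set (ℂ × ℂ)} (hne : Ω.Nonempty)
    (hA : Ω ⊆ attractedSet F)
    (hlim : ∀ m : ℕ → ℕ, StrictMono m → ∀ a : ℂ, ∃ p ∈ Ω, ∃ χ : ℕ → ℕ, StrictMono χ ∧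
      Tendsto (fun k => F^[m (χ k)] p) atTop (𝓝 (0, a)))
    {h : ℂ × ℂ → OnePoint (ℂ × ℂ)} (hh : IsLimitMap F Ω h) :
    h '' Ω = (fun p : ℂ × ℂ => (p : OnePoint (ℂ × ℂ))) '' wAxis := by
  obtain ⟨m, hm, ⟨h₀, -, hu, he⟩ | ⟨hd, -⟩⟩ := hh
  · have hpt : ∀ x ∈ Ω, Tendsto (fun k => F^[m k] x) atTop (𝓝 (h₀ x)) :=
      fun x hx => (hu {x} (by simpa using hx) isCompact_singleton).tendsto_at rfl
    apply Set.Subset.antisymm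
    · rintro _ ⟨p, hp, rfl⟩
      refine ⟨h₀ p, mem_wAxis.2 ?_, (he p hp).symm⟩
      exact tendsto_nhds_unique ((continuous_fst.tendsto _).comp (hpt p hp))
        ((hA hp).1.comp hm.tendsto_atTop)
    · rintro _ ⟨q, hq, rfl⟩
      obtain ⟨p, hp, χ, hχ, hpχ⟩ := hlim m hm q.2
      refine ⟨p, hp, ?_⟩
      have h1 := tendsto_nhds_unique ((hpt p hp).comp hχ.tendsto_atTop) hpχ
      have h2 : h₀ p = q := h1.trans (Prod.ext (mem_wAxis.1 hq).symm rfl)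
      rw [he p hp, h2]
  · obtain ⟨p, hp⟩ := hne
    obtain ⟨B, hB⟩ := (hA hp).2
    exact absurd hd (not_compactlyDivergesOn_of_bounded hp hB)

/-- On a compact subset of Ω, ‖z‖ has a positive minimum, while z_n → 0. -/
theorem isNonRecurrent_of_attracted {F : ℂ × ℂ → ℂ × ℂ} {Ω : Set (ℂ × ℂ)}
    (hA : Ω ⊆ attractedSet F) (hd : ∀ p ∈ Ω, p ∉ wAxis) : IsNonRecurrent F Ω := by
  intro p hp K hK hKc
  rcases K.eq_empty_or_nonempty with rfl | hKne
  · simp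
  obtain ⟨q, hq, hmin⟩ := hKc.exists_isMinOn hKne (f := fun x : ℂ × ℂ => ‖x.1‖) (by fun_prop)
  have hpos : 0 < ‖q.1‖ := norm_pos_iff.2 fun h0 => hd q (hK hq) (mem_wAxis.2 h0)
  have h1 := (hA hp).1.norm
  rw [norm_zero] at h1
  filter_upwards [h1.eventually (gt_mem_nhds hpos)] with n hn hnK
  exact absurd hn (not_lt.2 (hmin hnK))

/-- Along a subsequence λ^m tends to some μ and the limit is (0, μv). On a slice of constant z, v is
within 1/2 of w, so it takes the value a/μ. -/
theorem exists_tendsto_in_petal {F : ℂ × ℂ → ℂ × ℂ} {lam α : ℂ} (hlam : ‖lam‖ = 1) (hα : α ≠ 0)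
    {R M B : ℝ} {v : ℂ × ℂ → ℂ}
    (hz : TendstoUniformlyOn (fun n p => (F^[n] p).1) (fun _ => 0) atTop (petal α R M))
    (hw : TendstoUniformlyOn (fun n p => lam⁻¹ ^ n * (F^[n] p).2) v atTop (petal α R M))
    (hv : DifferentiableOn ℂ v (petal α R M)) (hB : ∀ p ∈ petal α R M, ‖v p‖ ≤ B)
    (hc : ∀ p ∈ petal α R M, ‖v p - p.2‖ ≤ 1 / 2)
    {m : ℕ → ℕ} (hm : StrictMono m) {a : ℂ} (ha : 4 * ‖a‖ + 4 < R) :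
    ∃ p ∈ petal α R M, ∃ χ : ℕ → ℕ, StrictMono χ ∧
      Tendsto (fun k => F^[m (χ k)] p) atTop (𝓝 (0, a)) := by
  obtain ⟨χ, hχ, μ, hμ, hμt⟩ := exists_subseq_pow_tendsto hlam m
  have hμ0 : μ ≠ 0 := norm_pos_iff.1 (by rw [hμ]; exact one_pos)
  have hmem : ∀ w ∈ Metric.ball (0 : ℂ) R,
      ((-(α * ((M + 1 : ℝ) : ℂ))⁻¹, w) : ℂ × ℂ) ∈ petal α R M :=
    fun w hw => mk_mem_petal hα (by simpa using hw) (by linarith)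
  obtain ⟨w, hwR, hwa⟩ := exists_eq_of_norm_sub_le
    (s := fun w => v (-(α * ((M + 1 : ℝ) : ℂ))⁻¹, w)) (a := μ⁻¹ * a)
    (hv.comp (f := fun w : ℂ => ((-(α * ((M + 1 : ℝ) : ℂ))⁻¹, w) : ℂ × ℂ)) (by fun_prop) hmem)
    (fun w hw => hc _ (hmem w hw)) (by rwa [norm_mul, norm_inv, hμ, inv_one, one_mul])
  refine ⟨_, hmem w hwR, χ, hχ, ?_⟩
  have h1 := (tendstoUniformlyOn_iterate_subseq hlam hB hz hw
    (hm.tendsto_atTop.comp hχ.tendsto_atTop) hμt).tendsto_at (hmem w hwR)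
  rw [hwa, ← mul_assoc, mul_inv_cancel₀ hμ0, one_mul] at h1
  exact h1

theorem wAxis_subset_closure {α : ℂ} (hα : α ≠ 0) {Ω : Set (ℂ × ℂ)} {M : ℕ → ℝ}
    (hΩ : ∀ R : ℕ, petal α R (M R) ⊆ Ω) : wAxis ⊆ closure Ω := by
  intro q hq
  obtain ⟨R, hR⟩ := exists_nat_gt ‖q.2‖
  have ht : Tendsto (fun t : ℝ => ((-(α * (t : ℂ))⁻¹, q.2) : ℂ × ℂ)) atTop (𝓝 q) := by
    have h1 : Tendsto (fun t : ℝ => -(α * (t : ℂ))⁻¹) atTop (𝓝 0) := by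
      rw [tendsto_zero_iff_norm_tendsto_zero]
      have e : ∀ t : ℝ, ‖-(α * (t : ℂ))⁻¹‖ = ‖α‖⁻¹ * |t|⁻¹ := fun t => by
        rw [norm_neg, norm_inv, norm_mul, Complex.norm_real, Real.norm_eq_abs, mul_inv]
      simp only [e]
      simpa using (tendsto_inv_atTop_zero.comp tendsto_abs_atTop_atTop).const_mul ‖α‖⁻¹
    have h2 := h1.prodMk_nhds (tendsto_const_nhds (x := q.2))
    rwa [← mem_wAxis.1 hq] at h2
  refine mem_closure_of_tendsto ht ?_
  filter_upwards [eventually_gt_atTop (M R)] with t ht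
  exact hΩ R (mk_mem_petal hα hR ht)

/-! ### Construction of the Fatou component -/

theorem mainTheorem2 (F : ℂ × ℂ → ℂ × ℂ) (θ : ℝ) (f g : ℂ → ℂ)
    (hF : IsHolomorphicAutomorphism F) (hθ : IsDiophantine θ)
    (hf : Differentiable ℂ f) (hg : Differentiable ℂ g)
    (hf0 : f 0 ≠ 0) (hg0 : g =O[𝓝 0] fun w => w ^ 2)
    (hform : HasForm F (Complex.exp (2 * Real.pi * Complex.I * θ)) f g) :
    ∃ Ω : Set (ℂ × ℂ),
      IsFatouComponent F Ω ∧ F '' Ω = Ω ∧ IsNonRecurrent F Ω ∧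
      (∀ h : ℂ × ℂ → OnePoint (ℂ × ℂ), IsLimitMap F Ω h →
        h '' Ω = (fun p : ℂ × ℂ => (p : OnePoint (ℂ × ℂ))) '' wAxis) ∧
      omegaLimitOn F Ω = wAxis ∧ wAxis ⊆ frontier Ω := by
  have hFd := hF.1
  obtain ⟨φ, ψ, hφ, hψ, hstep⟩ := hθ.exists_hasStepEstimates hFd hf hg hg0 hform
  have hlam := norm_exp_two_pi_mul_I_mul θ
  generalize Complex.exp (2 * Real.pi * Complex.I * θ) = lam at *
  obtain ⟨M, v, hMv⟩ := exists_petals hFd hstep hlam hf0 hφ.continuous hψ.continuous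
  choose hM hz hw hv hpt using hMv
  have hopen : ∀ R : ℕ, IsOpen (petal (f 0) R (M R)) := fun R => isOpen_petal hf0 (hM R).le
  have hfatou : ∀ R : ℕ, petal (f 0) R (M R) ⊆ fatouSet F := fun R p hp =>
    ⟨_, hopen R, hp, iteratesNormalOn_of_tendstoUniformlyOn hFd hlam (hv R)
      (fun p hp => (hpt R p hp).2.1) (hz R) (hw R)⟩
  have hattr : ∀ R : ℕ, petal (f 0) R (M R) ⊆ attractedSet F := fun R =>
    petal_subset_attractedSet (hz R) fun p hp => (hpt R p hp).2.2.1
  -- a base point in the petal over the unit disc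
  set p₀ : ℂ × ℂ := (-(f 0 * ((M 1 + 1 : ℝ) : ℂ))⁻¹, 0) with hp₀def
  have hp₀ : p₀ ∈ petal (f 0) (1 : ℕ) (M 1) := mk_mem_petal hf0 (by simp) (by linarith)
  set Ω := connectedComponentIn (fatouSet F) p₀ with hΩdef
  have hp₀Ω : p₀ ∈ Ω := mem_connectedComponentIn (hfatou 1 hp₀)
  have hΩopen : IsOpen Ω := (isOpen_fatouSet F).connectedComponentIn
  have hpetal : ∀ R : ℕ, petal (f 0) R (M R) ⊆ Ω := by
    -- Consecutive petals share points over w = 0 deep in both half-planes. The chain starts at R =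
    -- 1, as the petal over R = 0 is empty.
    have hchain : ∀ n : ℕ, (petal (f 0) (n + 1 : ℕ) (M (n + 1)) ∩
        petal (f 0) (n + 2 : ℕ) (M (n + 2))).Nonempty := by
      intro n
      refine ⟨_, mk_mem_petal hf0 (t := max (M (n + 1)) (M (n + 2)) + 1) (w := 0) ?_ ?_,
        mk_mem_petal hf0 ?_ ?_⟩
      · rw [norm_zero]; positivity
      · exact (le_max_left _ _).trans_lt (lt_add_one _)
      · rw [norm_zero]; positivity
      · exact (le_max_right _ _).trans_lt (lt_add_one _)
    have hconn : IsPreconnected (⋃ n : ℕ, petal (f 0) (n + 1 : ℕ) (M (n + 1))) :=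
      IsPreconnected.iUnion_of_chain (fun n => isPreconnected_petal hf0 (hM (n + 1)).le) hchain
    have hsub := hconn.subset_connectedComponentIn
      (Set.mem_iUnion.2 ⟨0, hp₀⟩) (Set.iUnion_subset fun n => hfatou (n + 1))
    intro R p hp
    rcases R with _ | n
    · exact absurd hp.1 (by simp)
    · exact hsub (Set.mem_iUnion.2 ⟨n, hp⟩)
  have hint : Ω ⊆ interior (attractedSet F) :=
    subset_interior_attractedSet isPreconnected_connectedComponentIn
      (connectedComponentIn_subset _ _)
      ⟨p₀, hp₀Ω, interior_maximal (hattr 1) (hopen 1) hp₀⟩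
  have hA : Ω ⊆ attractedSet F := hint.trans interior_subset
  have hdisj : ∀ p ∈ Ω, p ∉ wAxis := by
    intro p hp hpa
    have hp' : p = (0, p.2) := Prod.ext (mem_wAxis.1 hpa) rfl
    have h1 := connectedComponentIn_subset _ _ hp
    have h2 := hint hp
    rw [hp'] at h1 h2
    exact hform.zero_prod_notMem hFd hf h1 h2
  have hlim : ∀ m : ℕ → ℕ, StrictMono m → ∀ a : ℂ, ∃ p ∈ Ω, ∃ χ : ℕ → ℕ, StrictMono χ ∧
      Tendsto (fun k => F^[m (χ k)] p) atTop (𝓝 (0, a)) := by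
    intro m hm a
    obtain ⟨R, hR⟩ := exists_nat_gt (4 * ‖a‖ + 4)
    obtain ⟨p, hp, h⟩ := exists_tendsto_in_petal hlam hf0 (hz R) (hw R) (hv R)
      (fun p hp => (hpt R p hp).2.1) (fun p hp => (hpt R p hp).1) hm hR
    exact ⟨p, hpetal R hp, h⟩
  refine ⟨Ω, ⟨p₀, hfatou 1 hp₀, rfl⟩, ?_, isNonRecurrent_of_attracted hA hdisj,
    fun h hh => image_limitMap_eq ⟨p₀, hp₀Ω⟩ hA hlim hh, omegaLimitOn_eq_wAxis hA hlim, ?_⟩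
  · obtain ⟨-, -, hbd, hre⟩ := hpt 1 p₀ hp₀
    -- The orbit of `p₀` keeps ‖w‖ ≤ 2, so it eventually stays in the petal over the disc of radius
    -- 3; two consecutive points in Ω give invariance.
    obtain ⟨n, hn⟩ := eventually_atTop.1 (hre.eventually (eventually_gt_atTop (M 3)))
    have hmem : ∀ k, n ≤ k → F^[k] p₀ ∈ Ω := fun k hk => hpetal 3
      ⟨(hbd k).trans_lt (by norm_num), hn k hk⟩
    refine hF.image_component_eq (hmem n le_rfl) ?_
    rw [← Function.iterate_succ_apply' F n p₀]
    exact hmem (n + 1) (Nat.le_succ n)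
  · rw [hΩopen.frontier_eq]
    exact fun q hq => ⟨wAxis_subset_closure hf0 hpetal hq, fun hqΩ => hdisj q hqΩ hq⟩
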